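/- **Setting.** Let $x^*\in\mathbb R^m$ and let $a>0$, $c\ge 1$, $\gamma,C,C_1,C_2,G>0$, $A,B\ge 0$ with $A+2B\|x^*\|^2>0$, and $r<\rho$ with $\|x^*\|\le\rho$ (all norms Euclidean). For a locally Lipschitz $V:\mathbb R^m\to\mathbb R$ let $\partial V(x)$ be the Clarke generalized gradient, i.e. the closed convex hull of all limits $\lim_i\nabla V(y_i)$ with $y_i\to x$ and $V$ differentiable at each $y_i$. Consider pairs $(V,F)$, $V:\mathbb R^m\to\mathbb R$ locally Lipschitz, $F:\mathbb R^m\to\mathbb R^m$ (the closed-loop drift), with $F(x^*)=0$ and 1. $\|F(x)-F(y)\|\le C\|x-y\|$ whenever $\|x\|,\|y\|\le\rho$; 2. $C_1\|x-x^*\|^a\le V(x)\le C_2\|x-x^*\|^a$ for all $x$; 3. $\|g\|\le G\|x-x^*\|^{a-1}$ for all $x$ and $g\in\partial V(x)$; 4. $\langle g,F(x)\rangle\le-\gamma V(x)^c$ for all $\|x\|\le\rho$ and $g\in\partial V(x)$. Given step sizes $\alpha_k$, consider random sequences in $\mathbb R^m$ with $x_{k+1}=x_k+\alpha_k(F(x_k)+w_k)$,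 where, with $\mathcal F_k=\sigma(x_0,w_0,\dots,x_{k-1},w_{k-1},x_k)$, the $w_k$ are square-integrable, $\mathbb E[w_k\mid\mathcal F_k]=0$, $\mathbb E[\|w_k\|^2\mid\mathcal F_k]\le A+B\|x_k\|^2$, and $\|x_k\|\le r$ almost surely for all $k\ge 0$. Write $E_k=\mathbb E\|x_k-x^*\|^2$. **Constants.** Given $\alpha,\mu,\mu_0>0$ put $$d_{a,c}=\tfrac{a(c-1)}2+1,\quad d=\tfrac{3d_{a,c}}{3d_{a,c}-1},\quad G_M=\tfrac2a\,G\,C_2^{\frac2a-1},\quad N_C=(C^2+1)(A+2B\|x^*\|^2),\quad \nu_4=\frac{2\gamma\,(C_1/C_2)^{c-1+\frac2a}}{a(1+\mu_0G_M)^2},$$ $$\phi=\tfrac12\,d_{a,c}\,\alpha^{2-\frac1{d_{a,c}}}\,\nu_4^{\frac1{d_{a,c}}}\Big(\tfrac{(\mu_0^2G_M^2+1)N_C}{2\mu}\Big)^{1-\frac1{d_{a,c}}},\qquad \omega=\frac{d_{a,c}\,\alpha^2(\mu_0^2G_M^2+1)N_C}{2\mu},\qquad \kappa=C_1^{-\frac2a}+2\mu_0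 .$$ **Theorem (a).** Let $\alpha,\mu>0$ and $0<\xi\le\frac{2d}3$. There is $K_0\ge 1$, depending only on $m,x^*,a,c,\gamma,C,C_1,C_2,G,A,B,r,\rho,\alpha,\mu,\xi$, such that for every real $K\ge K_0$, with $\alpha_k=\alpha/(k+K)^{\xi}$ and smoothing parameters $\mu_k=\mu/(k+K)^{\xi/2}$ (so that $\mu_0=\mu/K^{\xi/2}$ in the constants above), all $(V,F)$ and $(x_k,w_k)$ as above satisfy for all $k\ge 0$: * if $\xi=\frac{2d}3$, $$E_k\le E_0\,C_2^{\frac2a}\,\kappa\Big(\frac K{k+K}\Big)^{\phi}+\kappa\times\begin{cases}\dfrac1{(k+K)^{\phi}}\,\dfrac{2^d\omega}{d-1-\phi}&\text{if }\phi<d-1,\\[2mm]\dfrac{\log(k+K)}{(k+K)^{d-1}}\,2^d\omega&\text{if }\phi=d-1,\\[2mm]\dfrac1{(k+K)^{d-1}}\,\dfrac{e\,2^d\omega}{\phi-(d-1)}&\text{if }\phi>d-1;\end{cases}$$ * if $0<\xi<\frac{2d}3$, with $\xi'=\frac{(3d_{a,c}-1)\xi}{2d_{a,c}}\in(0,1)$,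 $$E_k\le E_0\,C_2^{\frac2a}\,\kappa\,\exp\Big[-\frac{\phi\big((k+K)^{1-\xi'}-K^{1-\xi'}\big)}{1-\xi'}\Big]+\frac{2\,\omega\,\kappa}{\phi\,(k+K)^{\xi/(2d_{a,c})}} .$$ **(b)** ($\xi=0$.) There is $\eta>0$, depending only on $m,x^*,a,c,\gamma,C,C_1,C_2,G,A,B,r,\rho$, such that whenever $\alpha>0$ and $0<\mu\le\eta$ satisfy $\alpha\mu+\alpha^2/\mu\le\eta\,\phi$ (where $\mu_0=\mu$), all $(V,F)$ and $(x_k,w_k)$ as above with $\alpha_k=\alpha$ satisfy, for all $k\ge 0$, $$E_k\le E_0\,C_2^{\frac2a}\,\kappa\,(1-\phi)^k+\frac{\omega\,\kappa}{\phi}.$$ -/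

import Mathlib

open MeasureTheory Filter Topology

noncomputable section

namespace NonsmoothSA

/-- The Clarke generalized gradient of `V` at `x`: the closed convex hull of all limits of
gradients `∇V(yᵢ)` along sequences `yᵢ → x` of points at which `V` is differentiable. -/
def clarkeGradient {E : Type*} [NormedAddCommGroup E] [InnerProductSpace ℝ E] [CompleteSpace E]
    (V : E → ℝ) (x : E) : Set E :=
  closure (convexHull ℝ
    {g : E | ∃ y : ℕ → E, (∀ i, DifferentiableAt ℝ V (y i)) ∧ Tendsto y atTop (𝓝 x) ∧
      Tendsto (fun i => gradient V (y i)) atTop (𝓝 g)})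

/-- The assumptions on the Lyapunov function `V` and the closed-loop drift `F`.  The growth
conditions on `V` hold on the whole space; the Lipschitz condition on `F` and the stability
condition are only required on the ball of radius `ρ` (for `c > 1` they cannot hold together on
the whole space). -/
structure SystemAssumptions {m : ℕ} (V : EuclideanSpace ℝ (Fin m) → ℝ)
    (F : EuclideanSpace ℝ (Fin m) → EuclideanSpace ℝ (Fin m)) (xs : EuclideanSpace ℝ (Fin m))
    (a c γ C C₁ C₂ G ρ : ℝ) : Prop where
  /-- `V` is locally Lipschitz. -/
  locallyLipschitz : LocallyLipschitz V
  /-- `xs` is a stationary point of the drift. -/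
  stationary : F xs = 0
  /-- `F` is `C`-Lipschitz on the ball of radius `ρ`. -/
  lipschitz : ∀ x y, ‖x‖ ≤ ρ → ‖y‖ ≤ ρ → ‖F x - F y‖ ≤ C * ‖x - y‖
  /-- Polynomial growth of `V`. -/
  growth : ∀ x, C₁ * ‖x - xs‖ ^ a ≤ V x ∧ V x ≤ C₂ * ‖x - xs‖ ^ a
  /-- Growth of the generalized gradients of `V`. -/
  gradientGrowth : ∀ x, ∀ g ∈ clarkeGradient V x, ‖g‖ ≤ G * ‖x - xs‖ ^ (a - 1)
  /-- Sub-exponential stability. -/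
  stability : ∀ x, ‖x‖ ≤ ρ → ∀ g ∈ clarkeGradient V x, inner ℝ g (F x) ≤ -γ * V x ^ c

/-- The σ-algebra generated by `x₀, w₀, …, x_{k-1}, w_{k-1}, x_k`. -/
@[reducible]
def history {m : ℕ} {Ω : Type*} (x w : ℕ → Ω → EuclideanSpace ℝ (Fin m)) (k : ℕ) :
    MeasurableSpace Ω :=
  (⨆ j ∈ Set.Iic k, MeasurableSpace.comap (x j) inferInstance) ⊔
    (⨆ j ∈ Set.Iio k, MeasurableSpace.comap (w j) inferInstance)

/-- `x` is a trajectory of stochastic approximation `x_{k+1} = x_k + α_k (F(x_k) + w_k)` with step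
sizes `step`, conditionally centred noise `w` whose conditional second moment is at most
`A + B ‖x_k‖²`, and iterates bounded by `r`. -/
structure IsTrajectory {m : ℕ} {Ω : Type*} [MeasurableSpace Ω] (P : Measure Ω)
    (F : EuclideanSpace ℝ (Fin m) → EuclideanSpace ℝ (Fin m)) (step : ℕ → ℝ) (A B r : ℝ)
    (x w : ℕ → Ω → EuclideanSpace ℝ (Fin m)) : Prop where
  measurable_x : ∀ k, Measurable (x k)
  measurable_w : ∀ k, Measurable (w k)
  /-- The noise is square-integrable. -/
  memLp_w : ∀ k, MemLp (w k) 2 P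
  update : ∀ k, ∀ᵐ ω ∂P, x (k + 1) ω = x k ω + step k • (F (x k ω) + w k ω)
  unbiased : ∀ k, P[w k | history x w k] =ᵐ[P] 0
  variance : ∀ k, P[fun ω => ‖w k ω‖ ^ 2 | history x w k] ≤ᵐ[P] fun ω => A + B * ‖x k ω‖ ^ 2
  /-- The iterates are bounded. -/
  bounded : ∀ k, ∀ᵐ ω ∂P, ‖x k ω‖ ≤ r

/-- The mean square error `E_k = 𝔼 ‖x_k - xs‖²`. -/
def mse {m : ℕ} {Ω : Type*} [MeasurableSpace Ω] (P : Measure Ω)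
    (x : ℕ → Ω → EuclideanSpace ℝ (Fin m)) (xs : EuclideanSpace ℝ (Fin m)) (k : ℕ) : ℝ :=
  ∫ ω, ‖x k ω - xs‖ ^ 2 ∂P

/-- `d_{a,c} = a (c - 1) / 2 + 1`. -/
def dac (a c : ℝ) : ℝ := a * (c - 1) / 2 + 1

/-- `d = 3 d_{a,c} / (3 d_{a,c} - 1)`. -/
def dExp (a c : ℝ) : ℝ := 3 * dac a c / (3 * dac a c - 1)

/-- `G_M = (2 / a) G C₂^{2/a - 1}`. -/
def gM (a G C₂ : ℝ) : ℝ := 2 / a * G * C₂ ^ (2 / a - 1)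

/-- `N_C = (C² + 1) (A + 2 B s²)`, where `s` is the norm of the equilibrium. -/
def nC (C A B s : ℝ) : ℝ := (C ^ 2 + 1) * (A + 2 * B * s ^ 2)

/-- `ν₄ = 2 γ (C₁ / C₂)^{c - 1 + 2/a} / (a (1 + μ₀ G_M)²)`. -/
def nu4 (a c γ C₁ C₂ G μ₀ : ℝ) : ℝ :=
  2 * γ * (C₁ / C₂) ^ (c - 1 + 2 / a) / (a * (1 + μ₀ * gM a G C₂) ^ 2)

/-- `(μ₀² G_M² + 1) N_C / (2 μ)`. -/
def noiseLevel (a C C₂ G A B s μ μ₀ : ℝ) : ℝ :=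
  (μ₀ ^ 2 * gM a G C₂ ^ 2 + 1) * nC C A B s / (2 * μ)

/-- `φ = ½ d_{a,c} α^{2 - 1/d_{a,c}} ν₄^{1/d_{a,c}} ((μ₀² G_M² + 1) N_C / (2 μ))^{1 - 1/d_{a,c}}`. -/
def phi (a c γ C C₁ C₂ G A B s α μ μ₀ : ℝ) : ℝ :=
  1 / 2 * dac a c * α ^ (2 - 1 / dac a c) * nu4 a c γ C₁ C₂ G μ₀ ^ (1 / dac a c) *
    noiseLevel a C C₂ G A B s μ μ₀ ^ (1 - 1 / dac a c)

/-- `ω = d_{a,c} α² (μ₀² G_M² + 1) N_C / (2 μ)`. -/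
def omega (a c C C₂ G A B s α μ μ₀ : ℝ) : ℝ :=
  dac a c * α ^ 2 * noiseLevel a C C₂ G A B s μ μ₀

/-- `1 / C₁^{2/a} + 2 μ₀`. -/
def envelopeConst (a C₁ μ₀ : ℝ) : ℝ := 1 / C₁ ^ (2 / a) + 2 * μ₀

end NonsmoothSA

end

/-! Put `W = V^{2/a}`. It is squeezed between two multiples of `‖x - xs‖²` but is not smooth, so the
Lyapunov function used is its Moreau envelope `M_μ(x) = min_y (W y + ‖x - y‖²/(2μ))`. Up to
constants (`κ` and `C₂^{2/a}`) its mean is the mean square error.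

Drift. If `y` attains the minimum at `x`, then `M_μ(x + v) ≤ M_μ(x) + ⟨x - y, v⟩/μ + ‖v‖²/(2μ)`. The
minimum property also says that a smooth function touches `V` from below at `y`. Hence `(x - y)/μ`
is `(2/a) V(y)^{2/a-1}` times a Clarke gradient of `V` at `y` (`mem_clarkeGradient_of_minorant`,
`exists_mem_clarkeGradient`). Stability applied at `y` then gives a decrease of order `M_μ^D`, where
`D = d_{a,c}`. Replacing `F x` by `F y` costs `C‖x - y‖²/μ`, which is `O(μ) M_μ(x)` by the gradient
bound (`envelope_drift_le`).

Noise. Since `‖x‖²/(2μ) - M_μ` is convex, conditional Jensen shows that centred noise raises the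
mean envelope by at most `α² 𝔼‖w‖²/(2μ)` (`integral_envelope_le`). No measurable choice of
minimizers is required.

Linearization. Bounding `s^D` below by its tangent at a well-chosen point turns the superlinear
decrease into a linear contraction at rate `2φ`, at the price of a constant `(D - 1)α²n` of the same
order as the noise term `α²n`; together they make `ω`. Three quarters of the rate `2φ`, that is
`3φ/2`, survive the distortion of `ν₄`. One `φ/4` is then spent on the errors linear in the envelope
and another on lowering `μ` from step to step, which leaves `φ`.

Recursion. With `n = k + K` the mean envelope satisfies `u(k+1) ≤ (1 - φ/n^{ξ'}) u(k) + ω/n^{3ξ/2}`.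
At `ξ = 2d/3` one has `ξ' = 1` and the recursion is harmonic; below it `ξ' < 1`; for constant steps
it is geometric. Each case is solved by an explicit supersolution. -/

namespace NonsmoothSA

/-! ### Clarke gradients and smooth minorants -/

open Metric in
/-- A Lipschitz function whose derivative in the direction `v` is at most `u` wherever it exists
near `y` grows at rate at most `u` along the segment from `y` in the direction `v`. -/
theorem lipschitz_le_of_fderiv_le {E : Type*} [NormedAddCommGroup E] [NormedSpace ℝ E]
    [FiniteDimensional ℝ E] [MeasurableSpace E] [BorelSpace E] {g : E → ℝ} {K : NNReal}
    (hg : LipschitzWith K g) {y v : E} {δ u t : ℝ}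
    (hu : ∀ z ∈ ball y δ, DifferentiableAt ℝ g z → fderiv ℝ g z v ≤ u)
    (ht : 0 ≤ t) (htδ : t * ‖v‖ < δ) : g (y + t • v) ≤ g y + t * u := by
  let vol : Measure E := Measure.addHaar
  have key : ∀ ε : ℝ, 0 < ε → ε + t * ‖v‖ < δ → g (y + t • v) ≤ g y + t * u + 2 * K * ε := by
    intro ε hε hεδ
    set ν : Measure E := vol.restrict (ball 0 ε) with hν
    have hfin : vol (ball (0 : E) ε) < ⊤ := measure_ball_lt_top
    have : IsFiniteMeasure ν := ⟨by simpa [hν] using hfin⟩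
    have hpos : 0 < ν.real Set.univ := by
      have : ν.real Set.univ = (vol (ball (0 : E) ε)).toReal := by simp [hν, Measure.real]
      rw [this]
      exact ENNReal.toReal_pos (measure_ball_pos vol 0 hε).ne' hfin.ne
    -- Rademacher's theorem says nothing about a single segment, which is a null set in dimension at
    -- least two. Averaging over base points in a small ball makes almost every translate usable,
    -- and the Lipschitz bound controls the averaging error by `K * ε`.
    let h : ℝ → ℝ := fun s => ∫ w, g (y + w + s • v) ∂ν
    have hgc : Continuous g := hg.continuous
    have hmem : ∀ᵐ w ∂ν, w ∈ ball (0 : E) ε := ae_restrict_mem measurableSet_ball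
    have hnear : ∀ w ∈ ball (0 : E) ε, ∀ p : E, |g (p + w) - g p| ≤ K * ε := by
      intro w hw p
      have := hg.dist_le_mul (p + w) p
      rw [Real.dist_eq, dist_eq_norm, add_sub_cancel_left] at this
      refine this.trans ?_
      have : ‖w‖ < ε := by simpa using hw
      gcongr
    have hint : ∀ s : ℝ, Integrable (fun w => g (y + w + s • v)) ν := by
      intro s
      refine Integrable.of_bound (C := |g (y + s • v)| + K * ε)
        (by fun_prop : Continuous fun w => g (y + w + s • v)).aestronglyMeasurable ?_
      filter_upwards [hmem] with w hw
      have := hnear w hw (y + s • v)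
      rw [show y + w + s • v = y + s • v + w by abel, Real.norm_eq_abs]
      have h2 := abs_add_le (g (y + s • v + w) - g (y + s • v)) (g (y + s • v))
      rw [sub_add_cancel] at h2
      linarith
    have hderiv : ∀ s : ℝ, HasDerivAt h (∫ w, fderiv ℝ g (y + w + s • v) v ∂ν) s := by
      intro s
      refine (hasDerivAt_integral_of_dominated_loc_of_lip (μ := ν) (s := Set.univ)
        (F := fun s w => g (y + w + s • v)) (F' := fun w => fderiv ℝ g (y + w + s • v) v)
        (bound := fun _ => K * ‖v‖) univ_mem (Eventually.of_forall fun s => (hint s).1) (hint s)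
        ?_ ?_ (integrable_const _) ?_).2
      · exact ((measurable_fderiv_apply_const ℝ g v).comp
          (by fun_prop : Measurable fun w : E => y + w + s • v)).aestronglyMeasurable
      · refine Eventually.of_forall fun w => LipschitzOnWith.of_dist_le_mul fun a _ b _ => ?_
        refine (hg.dist_le_mul _ _).trans ?_
        rw [dist_eq_norm, add_sub_add_left_eq_sub, ← sub_smul, norm_smul, dist_eq_norm]
        simp only [Real.coe_nnabs, abs_mul, NNReal.abs_eq, abs_norm]
        exact le_of_eq (by ring)
      · have hae : ∀ᵐ w ∂vol, DifferentiableAt ℝ g ((y + s • v) + w) :=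
          (measurePreserving_add_left vol (y + s • v)).quasiMeasurePreserving.ae
            hg.ae_differentiableAt
        filter_upwards [ae_restrict_of_ae hae] with w hw
        rw [show y + s • v + w = y + w + s • v by abel] at hw
        have h1 : HasDerivAt (fun s : ℝ => y + w + s • v) v s := by
          simpa using ((hasDerivAt_id s).smul_const v).const_add (y + w)
        exact hw.hasFDerivAt.comp_hasDerivAt s h1
    have hbound : ∀ s ∈ Set.Icc 0 t, ∫ w, fderiv ℝ g (y + w + s • v) v ∂ν ≤ u * ν.real Set.univ := by
      intro s hs
      have hae : ∀ᵐ w ∂vol, DifferentiableAt ℝ g ((y + s • v) + w) :=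
        (measurePreserving_add_left vol (y + s • v)).quasiMeasurePreserving.ae
          hg.ae_differentiableAt
      have hle : ∀ᵐ w ∂ν, fderiv ℝ g (y + w + s • v) v ≤ u := by
        filter_upwards [ae_restrict_of_ae hae, hmem] with w hw hwε
        rw [show y + s • v + w = y + w + s • v by abel] at hw
        refine hu _ ?_ hw
        rw [mem_ball, dist_eq_norm, show y + w + s • v - y = w + s • v by abel]
        have h1 : ‖w‖ < ε := by simpa using hwε
        have h2 : ‖s • v‖ ≤ t * ‖v‖ := by
          rw [norm_smul, Real.norm_of_nonneg hs.1]
          exact mul_le_mul_of_nonneg_right hs.2 (norm_nonneg _)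
        linarith [norm_add_le w (s • v)]
      have hi : Integrable (fun w => fderiv ℝ g (y + w + s • v) v) ν := by
        refine Integrable.of_bound (C := K * ‖v‖)
          ((measurable_fderiv_apply_const ℝ g v).comp
            (by fun_prop : Measurable fun w : E => y + w + s • v)).aestronglyMeasurable
          (Eventually.of_forall fun w => ?_)
        exact (ContinuousLinearMap.le_opNorm _ _).trans
          (mul_le_mul_of_nonneg_right (norm_fderiv_le_of_lipschitz ℝ hg) (norm_nonneg _))
      have := integral_mono_ae hi (integrable_const u) hle
      simpa [mul_comm] using this
    have hmv : h t - h 0 ≤ u * ν.real Set.univ * (t - 0) := by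
      refine (convex_Icc 0 t).image_sub_le_mul_sub_of_deriv_le
        (fun s _ => (hderiv s).continuousAt.continuousWithinAt)
        (fun s _ => (hderiv s).differentiableAt.differentiableWithinAt) ?_ 0 (by simp [ht]) t
        (by simp [ht]) ht
      intro s hs
      rw [(hderiv s).deriv]
      exact hbound s (interior_subset hs)
    have h1 : (g (y + t • v) - K * ε) * ν.real Set.univ ≤ h t := by
      have := integral_mono_ae (integrable_const (g (y + t • v) - K * ε)) (hint t) (by
        filter_upwards [hmem] with w hw
        have := (abs_le.1 (hnear w hw (y + t • v))).1
        rw [show y + w + t • v = y + t • v + w by abel]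
        linarith)
      simpa [mul_comm] using this
    have h0 : h 0 ≤ (g y + K * ε) * ν.real Set.univ := by
      have := integral_mono_ae (hint 0) (integrable_const (g y + K * ε)) (by
        filter_upwards [hmem] with w hw
        have := (abs_le.1 (hnear w hw y)).2
        simp only [zero_smul, add_zero]
        linarith)
      simpa [h, mul_comm] using this
    have : (g (y + t • v) - K * ε) * ν.real Set.univ
        ≤ (g y + K * ε + u * t) * ν.real Set.univ := by nlinarith
    have := le_of_mul_le_mul_right this hpos
    linarith
  have hlim : Tendsto (fun ε : ℝ => g y + t * u + 2 * K * ε) (𝓝[>] 0) (𝓝 (g y + t * u)) := by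
    have : Continuous fun ε : ℝ => g y + t * u + 2 * K * ε := by fun_prop
    simpa using (this.tendsto 0).mono_left nhdsWithin_le_nhds
  refine ge_of_tendsto hlim ?_
  have : Set.Ioo 0 (δ - t * ‖v‖) ∈ 𝓝[>] (0 : ℝ) := Ioo_mem_nhdsGT (by linarith)
  filter_upwards [this] with ε hε
  exact key ε hε.1 (by linarith [hε.2])

open Metric in
/-- If a function `ψ` differentiable at `y` touches the locally Lipschitz function `V` from below
at `y`, then its gradient belongs to the Clarke generalized gradient of `V`. -/
theorem mem_clarkeGradient_of_minorant {m : ℕ} {V ψ : EuclideanSpace ℝ (Fin m) → ℝ}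
    (hV : LocallyLipschitz V) {y p : EuclideanSpace ℝ (Fin m)} (hψ : HasGradientAt ψ p y)
    (hle : ∀ᶠ z in 𝓝 y, ψ z ≤ V z) (heq : ψ y = V y) : p ∈ clarkeGradient V y := by
  by_contra hp
  obtain ⟨f, u, hfu, hup⟩ := geometric_hahn_banach_closed_point
    (convex_convexHull ℝ _).closure isClosed_closure hp
  obtain ⟨K, s, hs, hKs⟩ := hV y
  obtain ⟨δ₀, hδ₀, hball⟩ := Metric.mem_nhds_iff.1 hs
  set v := (InnerProductSpace.toDual ℝ (EuclideanSpace ℝ (Fin m))).symm f with hv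
  have hfv : ∀ g, f g = inner ℝ v g := fun g => by
    rw [hv, InnerProductSpace.toDual_symm_apply]
  have hgrad : ∀ z, f (gradient V z) = fderiv ℝ V z v := fun z => by
    rw [hfv, real_inner_comm, gradient, InnerProductSpace.toDual_symm_apply]
  -- Otherwise points tending to `y` would have gradients, bounded by the local Lipschitz constant,
  -- on which `f ≥ u`. A limit of a subsequence lies in the Clarke gradient and contradicts the
  -- separation.
  obtain ⟨δ, hδ, hδu⟩ : ∃ δ, 0 < δ ∧ ∀ z ∈ ball y δ, DifferentiableAt ℝ V z →
      fderiv ℝ V z v ≤ u := by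
    by_contra! hcon
    have hn : ∀ n : ℕ, (0 : ℝ) < 1 / (n + 1) := fun n => by positivity
    choose z hz hzd hzu using fun n : ℕ => hcon _ (hn n)
    have hzy : Tendsto z atTop (𝓝 y) := by
      rw [tendsto_iff_dist_tendsto_zero]
      exact squeeze_zero (fun _ => dist_nonneg) (fun n => (mem_ball.1 (hz n)).le)
        tendsto_one_div_add_atTop_nhds_zero_nat
    obtain ⟨N, hN⟩ := (hzy.eventually (ball_mem_nhds y hδ₀)).exists_forall_of_atTop
    have hbd : ∀ n, gradient V (z (n + N)) ∈ closedBall (0 : EuclideanSpace ℝ (Fin m)) K := by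
      intro n
      rw [mem_closedBall_zero_iff, gradient, LinearIsometryEquiv.norm_map]
      refine norm_fderiv_le_of_lipschitzOn ℝ (s := ball y δ₀) ?_ (hKs.mono hball)
      exact isOpen_ball.mem_nhds (hN _ (by omega))
    obtain ⟨g, -, φ, hφ, hg⟩ := tendsto_subseq_of_bounded isBounded_closedBall hbd
    have hgS : g ∈ clarkeGradient V y := by
      refine subset_closure (subset_convexHull ℝ _ ⟨fun i => z (φ i + N), fun i => hzd _, ?_, hg⟩)
      exact hzy.comp ((tendsto_add_atTop_nat N).comp hφ.tendsto_atTop)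
    have h1 := hfu g hgS
    have h2 : u ≤ f g := by
      refine ge_of_tendsto ((f.continuous.tendsto g).comp hg) (Eventually.of_forall fun n => ?_)
      simp only [Function.comp]
      rw [hgrad]
      exact (hzu _).le
    linarith
  -- The averaging lemma wants a globally Lipschitz function; `g` agrees with `V` near `y`.
  obtain ⟨g, hgL, hgV⟩ := (hKs.mono hball).extend_real
  have hδ' : 0 < min δ δ₀ := lt_min hδ hδ₀
  have hgu : ∀ z ∈ ball y (min δ δ₀), DifferentiableAt ℝ g z → fderiv ℝ g z v ≤ u := by
    intro z hz hd
    have hz0 : z ∈ ball y δ₀ := ball_subset_ball (min_le_right _ _) hz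
    have he : V =ᶠ[𝓝 z] g := by
      filter_upwards [isOpen_ball.mem_nhds hz0] with w hw using hgV hw
    rw [← he.fderiv_eq]
    exact hδu z (ball_subset_ball (min_le_left _ _) hz) (he.differentiableAt_iff.2 hd)
  have hline : HasDerivAt (fun t : ℝ => ψ (y + t • v)) (f p) 0 := by
    have h1 : HasDerivAt (fun s : ℝ => y + s • v) v 0 := by
      simpa using ((hasDerivAt_id (0 : ℝ)).smul_const v).const_add y
    have h2 := hψ.hasFDerivAt
    have h3 : HasFDerivAt ψ (InnerProductSpace.toDual ℝ _ p) (y + (0 : ℝ) • v) := by simpa using h2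
    have := h3.comp_hasDerivAt (0 : ℝ) h1
    rw [InnerProductSpace.toDual_apply_apply] at this
    rw [hfv, real_inner_comm]
    exact this
  have hslope := hline.tendsto_slope_zero_right
  have hcont : Tendsto (fun t : ℝ => y + t • v) (𝓝[>] 0) (𝓝 y) := by
    have : Continuous fun t : ℝ => y + t • v := by fun_prop
    simpa using (this.tendsto 0).mono_left nhdsWithin_le_nhds
  have hnorm : ∀ᶠ t : ℝ in 𝓝[>] 0, t * ‖v‖ < min δ δ₀ := by
    have : Continuous fun t : ℝ => t * ‖v‖ := by fun_prop
    have := (this.tendsto 0).mono_left (nhdsWithin_le_nhds (s := Set.Ioi 0))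
    rw [zero_mul] at this
    exact this.eventually (gt_mem_nhds hδ')
  -- The slope of `ψ` along `v` is `f p`, and `ψ` lies below `V`, whose growth rate along `v` is at
  -- most `u`.
  have hlast : f p ≤ u := by
    refine le_of_tendsto hslope ?_
    filter_upwards [hcont.eventually hle, hcont.eventually (ball_mem_nhds y hδ₀), hnorm,
      self_mem_nhdsWithin] with t ht1 ht2 ht3 ht0
    have ht0 : 0 < t := ht0
    have h1 := lipschitz_le_of_fderiv_le hgL hgu ht0.le ht3
    rw [← hgV ht2, ← hgV (mem_ball_self hδ₀)] at h1
    simp only [zero_add, zero_smul, add_zero, smul_eq_mul]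
    rw [heq, inv_mul_le_iff₀ ht0]
    linarith
  linarith


/-! ### The Moreau envelope of a nonnegative continuous function -/

section Envelope

variable {E : Type*} [NormedAddCommGroup E]

/-- The Moreau envelope of `W` with smoothing parameter `μ`. -/
noncomputable def moreauEnvelope (W : E → ℝ) (μ : ℝ) (x : E) : ℝ :=
  ⨅ y, (W y + ‖x - y‖ ^ 2 / (2 * μ))

/-- `y` attains the infimum in the Moreau envelope of `W` at `x`. -/
def IsProx (W : E → ℝ) (μ : ℝ) (x y : E) : Prop :=
  ∀ z, W y + ‖x - y‖ ^ 2 / (2 * μ) ≤ W z + ‖x - z‖ ^ 2 / (2 * μ)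

variable {W : E → ℝ} {μ : ℝ}

theorem moreauEnvelope_le (hW0 : ∀ z, 0 ≤ W z) (hμ : 0 < μ) (x z : E) :
    moreauEnvelope W μ x ≤ W z + ‖x - z‖ ^ 2 / (2 * μ) := by
  refine ciInf_le ⟨0, ?_⟩ z
  rintro _ ⟨y, rfl⟩
  exact add_nonneg (hW0 y) (by positivity)

theorem IsProx.moreauEnvelope_eq {x y : E} (h : IsProx W μ x y) (hW0 : ∀ z, 0 ≤ W z)
    (hμ : 0 < μ) : moreauEnvelope W μ x = W y + ‖x - y‖ ^ 2 / (2 * μ) :=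
  le_antisymm (moreauEnvelope_le hW0 hμ x y) (le_ciInf h)

theorem moreauEnvelope_nonneg (hW0 : ∀ z, 0 ≤ W z) (hμ : 0 < μ) (x : E) :
    0 ≤ moreauEnvelope W μ x :=
  le_ciInf fun y => add_nonneg (hW0 y) (by positivity)

variable [InnerProductSpace ℝ E]

theorem exists_isProx [FiniteDimensional ℝ E] (hW : Continuous W) (hW0 : ∀ z, 0 ≤ W z)
    (hμ : 0 < μ) (x : E) : ∃ y, IsProx W μ x y := by
  have : ProperSpace E := FiniteDimensional.proper ℝ E
  refine Continuous.exists_forall_le (f := fun z => W z + ‖x - z‖ ^ 2 / (2 * μ)) (by fun_prop) ?_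
  refine tendsto_atTop_mono (fun z => le_add_of_nonneg_left (hW0 z)) ?_
  refine Tendsto.atTop_div_const (by positivity) ((tendsto_pow_atTop two_ne_zero).comp ?_)
  have h1 : Tendsto (fun z : E => ‖z‖ - ‖x‖) (cocompact E) atTop :=
    tendsto_atTop_add_const_right _ _ (tendsto_norm_cocompact_atTop (E := E))
  refine tendsto_atTop_mono (fun z => ?_) h1
  rw [norm_sub_rev]
  exact norm_sub_norm_le z x

/-- The Moreau envelope is smooth from above. -/
theorem IsProx.moreauEnvelope_add_le {x y : E} (h : IsProx W μ x y) (hW0 : ∀ z, 0 ≤ W z)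
    (hμ : 0 < μ) (v : E) :
    moreauEnvelope W μ (x + v)
      ≤ moreauEnvelope W μ x + inner ℝ (x - y) v / μ + ‖v‖ ^ 2 / (2 * μ) := by
  refine (moreauEnvelope_le hW0 hμ _ y).trans (le_of_eq ?_)
  rw [h.moreauEnvelope_eq hW0 hμ, show x + v - y = (x - y) + v by abel, norm_add_sq_real]
  field_simp
  ring

/-- The Moreau envelope is the difference of a quadratic and a convex function. -/
theorem convexOn_sub_moreauEnvelope [FiniteDimensional ℝ E] (hW : Continuous W)
    (hW0 : ∀ z, 0 ≤ W z) (hμ : 0 < μ) :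
    ConvexOn ℝ Set.univ fun x => ‖x‖ ^ 2 / (2 * μ) - moreauEnvelope W μ x := by
  refine ⟨convex_univ, fun b _ c _ s t hs ht hst => ?_⟩
  -- The function is a supremum over `y` of functions affine in `x`; the affine piece that is
  -- attained at the convex combination supports it there.
  obtain ⟨y, hy⟩ := exists_isProx hW hW0 hμ (s • b + t • c)
  have hexp : ∀ x : E, ‖x‖ ^ 2 / (2 * μ) - (W y + ‖x - y‖ ^ 2 / (2 * μ))
      = inner ℝ x y / μ - (W y + ‖y‖ ^ 2 / (2 * μ)) := by
    intro x
    rw [norm_sub_sq_real]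
    field_simp
    ring
  have hle : ∀ x : E, inner ℝ x y / μ - (W y + ‖y‖ ^ 2 / (2 * μ))
      ≤ ‖x‖ ^ 2 / (2 * μ) - moreauEnvelope W μ x := by
    intro x
    rw [← hexp]
    linarith [moreauEnvelope_le hW0 hμ x y]
  simp only [smul_eq_mul]
  rw [hy.moreauEnvelope_eq hW0 hμ, hexp, inner_add_left, real_inner_smul_left,
    real_inner_smul_left]
  have h1 := mul_le_mul_of_nonneg_left (hle b) hs
  have h2 := mul_le_mul_of_nonneg_left (hle c) ht
  have h3 : (s * inner ℝ b y + t * inner ℝ c y) / μ - (W y + ‖y‖ ^ 2 / (2 * μ))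
      = s * (inner ℝ b y / μ - (W y + ‖y‖ ^ 2 / (2 * μ)))
        + t * (inner ℝ c y / μ - (W y + ‖y‖ ^ 2 / (2 * μ))) := by
    have : t = 1 - s := by linarith
    subst this
    ring
  linarith

theorem continuous_moreauEnvelope [FiniteDimensional ℝ E] (hW : Continuous W)
    (hW0 : ∀ z, 0 ≤ W z) (hμ : 0 < μ) : Continuous (moreauEnvelope W μ) := by
  have h := (convexOn_sub_moreauEnvelope hW hW0 hμ).continuousOn isOpen_univ
  rw [← continuousOn_univ]
  have h2 : ContinuousOn (fun x : E => ‖x‖ ^ 2 / (2 * μ)) Set.univ := by fun_prop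
  refine (h2.sub h).congr fun x _ => ?_
  simp

end Envelope

/-! ### Proximal points of `V^{2/a}` -/

/-- A bound on the growth of the gradient of `V^{2/a}`. -/
noncomputable def slopeBound (a C₁ C₂ G : ℝ) : ℝ := 2 / a * G * (C₁ ^ (2 / a - 1) + C₂ ^ (2 / a - 1))

theorem slopeBound_pos {a C₁ C₂ G : ℝ} (ha : 0 < a) (hC₁ : 0 < C₁) (hC₂ : 0 < C₂) (hG : 0 < G) :
    0 < slopeBound a C₁ C₂ G := by
  unfold slopeBound
  positivity

section System

variable {m : ℕ} {V : EuclideanSpace ℝ (Fin m) → ℝ}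
    {F : EuclideanSpace ℝ (Fin m) → EuclideanSpace ℝ (Fin m)} {xs : EuclideanSpace ℝ (Fin m)}
    {a c γ C C₁ C₂ G ρ μ : ℝ}

theorem SystemAssumptions.nonneg (h : SystemAssumptions V F xs a c γ C C₁ C₂ G ρ) (hC₁ : 0 < C₁)
    (z : EuclideanSpace ℝ (Fin m)) : 0 ≤ V z :=
  le_trans (by positivity) (h.growth z).1

theorem SystemAssumptions.rpow_nonneg (h : SystemAssumptions V F xs a c γ C C₁ C₂ G ρ)
    (hC₁ : 0 < C₁) (z : EuclideanSpace ℝ (Fin m)) : 0 ≤ V z ^ (2 / a) :=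
  Real.rpow_nonneg (h.nonneg hC₁ z) _

theorem SystemAssumptions.continuous_rpow (h : SystemAssumptions V F xs a c γ C C₁ C₂ G ρ)
    (ha : 0 < a) : Continuous fun z => V z ^ (2 / a) :=
  h.locallyLipschitz.continuous.rpow_const fun _ => Or.inr (by positivity)

theorem rpow_two_div_of_mul_rpow {a B t : ℝ} (ha : 0 < a) (hB : 0 < B) (ht : 0 ≤ t) :
    (B * t ^ a) ^ (2 / a) = B ^ (2 / a) * t ^ 2 := by
  rw [Real.mul_rpow hB.le (by positivity), ← Real.rpow_mul ht, mul_div_cancel₀ _ ha.ne']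
  norm_num

theorem SystemAssumptions.le_rpow (h : SystemAssumptions V F xs a c γ C C₁ C₂ G ρ)
    (ha : 0 < a) (hC₁ : 0 < C₁) (z : EuclideanSpace ℝ (Fin m)) :
    C₁ ^ (2 / a) * ‖z - xs‖ ^ 2 ≤ V z ^ (2 / a) := by
  rw [← rpow_two_div_of_mul_rpow ha hC₁ (norm_nonneg _)]
  exact Real.rpow_le_rpow (by positivity) (h.growth z).1 (by positivity)

theorem SystemAssumptions.rpow_le (h : SystemAssumptions V F xs a c γ C C₁ C₂ G ρ)
    (ha : 0 < a) (hC₁ : 0 < C₁) (hC₂ : 0 < C₂) (z : EuclideanSpace ℝ (Fin m)) :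
    V z ^ (2 / a) ≤ C₂ ^ (2 / a) * ‖z - xs‖ ^ 2 := by
  rw [← rpow_two_div_of_mul_rpow ha hC₂ (norm_nonneg _)]
  exact Real.rpow_le_rpow (h.nonneg hC₁ z) (h.growth z).2 (by positivity)

theorem SystemAssumptions.apply_stationary (h : SystemAssumptions V F xs a c γ C C₁ C₂ G ρ)
    (ha : 0 < a) : V xs = 0 := by
  have := h.growth xs
  simp only [sub_self, norm_zero, Real.zero_rpow ha.ne', mul_zero] at this
  linarith [this.1, this.2]

theorem SystemAssumptions.pos (h : SystemAssumptions V F xs a c γ C C₁ C₂ G ρ)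
    (hC₁ : 0 < C₁) {y : EuclideanSpace ℝ (Fin m)} (hy : y ≠ xs) : 0 < V y := by
  have h1 : 0 < ‖y - xs‖ := norm_pos_iff.2 (sub_ne_zero.2 hy)
  have := (h.growth y).1
  have : 0 < C₁ * ‖y - xs‖ ^ a := by positivity
  linarith

/-- Moving from `xs` a fraction `t` towards `x` costs order `t²` in `V^{2/a}` but gains order `t` in
the quadratic term. This disposes of the one point where `V` vanishes and the chain rule for
`V^{2/a}` is unavailable. -/
theorem SystemAssumptions.eq_of_isProx_stationary
    (h : SystemAssumptions V F xs a c γ C C₁ C₂ G ρ) (ha : 0 < a) (hC₁ : 0 < C₁) (hC₂ : 0 < C₂)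
    (hμ : 0 < μ) {x : EuclideanSpace ℝ (Fin m)}
    (hx : IsProx (fun z => V z ^ (2 / a)) μ x xs) : x = xs := by
  by_contra hne
  have hpos : 0 < ‖x - xs‖ ^ 2 := pow_pos (norm_pos_iff.2 (sub_ne_zero.2 hne)) 2
  set N := ‖x - xs‖ ^ 2 with hN
  set b := 2 * μ * C₂ ^ (2 / a) with hb
  have hb0 : 0 < b := by positivity
  -- This minimizes `b * t² + (1 - t)²`, with value `1 - t < 1`.
  set t := 1 / (b + 1) with ht
  have ht0 : 0 < t := by positivity
  have h1 := hx (xs + t • (x - xs))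
  have h2 := h.rpow_le ha hC₁ hC₂ (xs + t • (x - xs))
  simp only [h.apply_stationary ha] at h1
  rw [Real.zero_rpow (by positivity), zero_add] at h1
  rw [add_sub_cancel_left, norm_smul, mul_pow, Real.norm_of_nonneg ht0.le] at h2
  rw [show x - (xs + t • (x - xs)) = (1 - t) • (x - xs) by module, norm_smul, mul_pow,
    Real.norm_eq_abs, sq_abs] at h1
  rw [← hN] at h1 h2
  have h3 : N / (2 * μ) ≤ C₂ ^ (2 / a) * (t ^ 2 * N) + (1 - t) ^ 2 * N / (2 * μ) :=
    h1.trans (by gcongr)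
  have h4 : N ≤ (b * t ^ 2 + (1 - t) ^ 2) * N := by
    have := mul_le_mul_of_nonneg_left h3 (by positivity : 0 ≤ 2 * μ)
    have e1 : 2 * μ * (N / (2 * μ)) = N := by field_simp
    have e2 : 2 * μ * (C₂ ^ (2 / a) * (t ^ 2 * N) + (1 - t) ^ 2 * N / (2 * μ))
        = (b * t ^ 2 + (1 - t) ^ 2) * N := by
      rw [hb]
      field_simp
    linarith
  have h5 : 1 ≤ b * t ^ 2 + (1 - t) ^ 2 := by
    by_contra hlt
    push Not at hlt
    nlinarith
  have h6 : (b + 1) * t = 1 := by rw [ht]; field_simp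
  nlinarith

/-- At a minimizer `y` of the Moreau envelope at `x`, the scaled displacement is a generalized
gradient of `V^{2/a}`. -/
theorem SystemAssumptions.exists_mem_clarkeGradient
    (h : SystemAssumptions V F xs a c γ C C₁ C₂ G ρ) (ha : 0 < a) (hC₁ : 0 < C₁)
    (hμ : 0 < μ) {x y : EuclideanSpace ℝ (Fin m)}
    (hx : IsProx (fun z => V z ^ (2 / a)) μ x y) (hy : y ≠ xs) :
    ∃ g ∈ clarkeGradient V y, μ⁻¹ • (x - y) = (2 / a * V y ^ (2 / a - 1)) • g := by
  have hVy := h.pos hC₁ hy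
  set p := μ⁻¹ • (x - y) with hp
  -- Minimality of `y` says that the quadratic `b` touches `V^{2/a}` from below at `y`, with
  -- gradient `p`. As `b y > 0`, its power `b^{a/2}` is differentiable at `y` and touches `V` from
  -- below; the scalar is the chain rule factor.
  refine ⟨(a / 2 * V y ^ (1 - 2 / a)) • p, ?_, ?_⟩
  · let b : EuclideanSpace ℝ (Fin m) → ℝ :=
      fun z => V y ^ (2 / a) + (‖x - y‖ ^ 2 - ‖x - z‖ ^ 2) / (2 * μ)
    have hby : b y = V y ^ (2 / a) := by simp [b]
    have hby0 : 0 < b y := by rw [hby]; positivity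
    have hbc : Continuous b := by fun_prop
    have hinv : ∀ s : ℝ, 0 ≤ s → (s ^ (2 / a)) ^ (a / 2) = s := by
      intro s hs
      rw [← Real.rpow_mul hs, show 2 / a * (a / 2) = 1 by field_simp, Real.rpow_one]
    refine mem_clarkeGradient_of_minorant (ψ := fun z => b z ^ (a / 2)) h.locallyLipschitz ?_ ?_ ?_
    · have h1 : HasFDerivAt (fun z : EuclideanSpace ℝ (Fin m) => ‖x - z‖ ^ 2)
          (2 • (innerSL ℝ (x - y)).comp (-ContinuousLinearMap.id ℝ _)) y := by
        have h0 : HasFDerivAt (fun z : EuclideanSpace ℝ (Fin m) => x - z)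
            (-ContinuousLinearMap.id ℝ _) y := by
          simpa using (hasFDerivAt_id y).const_sub x
        exact h0.norm_sq
      have h2 : HasFDerivAt b (InnerProductSpace.toDual ℝ _ p) y := by
        have h3 := ((h1.const_sub (‖x - y‖ ^ 2)).mul_const (2 * μ)⁻¹).const_add (V y ^ (2 / a))
        refine (h3.congr_fderiv ?_).congr_of_eventuallyEq (Eventually.of_forall fun z => ?_)
        · ext v
          simp only [hp, _root_.smul_apply, _root_.neg_apply,
            ContinuousLinearMap.comp_apply, innerSL_apply_apply, ContinuousLinearMap.id_apply,
            InnerProductSpace.toDual_apply_apply, real_inner_smul_left, inner_neg_right,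
            smul_eq_mul, nsmul_eq_mul]
          field_simp
          simp
        · simp [b, div_eq_mul_inv]
      have h4 := h2.rpow_const (p := a / 2) (Or.inl hby0.ne')
      rw [hasGradientAt_iff_hasFDerivAt]
      refine h4.congr_fderiv ?_
      rw [hby, ← Real.rpow_mul hVy.le, show 2 / a * (a / 2 - 1) = 1 - 2 / a by field_simp]
      ext v
      simp
    · filter_upwards [hbc.tendsto y |>.eventually (lt_mem_nhds hby0)] with z hz
      have h1 := hx z
      have h2 : b z ≤ V z ^ (2 / a) := by
        simp only [b]
        simp only at h1
        rw [sub_div]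
        linarith
      calc b z ^ (a / 2) ≤ (V z ^ (2 / a)) ^ (a / 2) :=
            Real.rpow_le_rpow hz.le h2 (by positivity)
        _ = V z := hinv _ (h.nonneg hC₁ z)
    · simp only [hby]
      exact hinv _ hVy.le
  · rw [smul_smul]
    have : 2 / a * V y ^ (2 / a - 1) * (a / 2 * V y ^ (1 - 2 / a)) = 1 := by
      have h1 : V y ^ (2 / a - 1) * V y ^ (1 - 2 / a) = 1 := by
        rw [← Real.rpow_add hVy]
        simp
      calc _ = (2 / a * (a / 2)) * (V y ^ (2 / a - 1) * V y ^ (1 - 2 / a)) := by ring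
        _ = 1 := by rw [h1]; field_simp
    rw [this, one_smul]

/-- The displacement is `μ` times a gradient of `V^{2/a}` at `y`, and the powers `‖y - xs‖^{2-a}`
and `‖y - xs‖^{a-1}` multiply to `‖y - xs‖`. The sign of `2/a - 1` decides which growth bound
controls `V^{2/a-1}`, so `slopeBound` adds both constants. -/
theorem SystemAssumptions.norm_sub_prox_le
    (h : SystemAssumptions V F xs a c γ C C₁ C₂ G ρ) (ha : 0 < a) (hC₁ : 0 < C₁) (hC₂ : 0 < C₂)
    (hG : 0 < G) (hμ : 0 < μ) {x y : EuclideanSpace ℝ (Fin m)}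
    (hx : IsProx (fun z => V z ^ (2 / a)) μ x y) :
    ‖x - y‖ ≤ μ * slopeBound a C₁ C₂ G * ‖y - xs‖ := by
  by_cases hy : y = xs
  · subst hy
    simp [h.eq_of_isProx_stationary ha hC₁ hC₂ hμ hx]
  · obtain ⟨g, hg, he⟩ := h.exists_mem_clarkeGradient ha hC₁ hμ hx hy
    have hVy := h.pos hC₁ hy
    have ht : 0 < ‖y - xs‖ := norm_pos_iff.2 (sub_ne_zero.2 hy)
    set t := ‖y - xs‖ with ht'
    have hg' := h.gradientGrowth y g hg
    have hpow : ∀ B : ℝ, 0 < B → (B * t ^ a) ^ (2 / a - 1) = B ^ (2 / a - 1) * t ^ (2 - a) := by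
      intro B hB
      rw [Real.mul_rpow hB.le (by positivity), ← Real.rpow_mul ht.le]
      congr 2
      field_simp
    have hV : V y ^ (2 / a - 1) ≤ (C₁ ^ (2 / a - 1) + C₂ ^ (2 / a - 1)) * t ^ (2 - a) := by
      rw [add_mul, ← hpow C₁ hC₁, ← hpow C₂ hC₂]
      rcases le_total 0 (2 / a - 1) with he | he
      · have := Real.rpow_le_rpow hVy.le (h.growth y).2 he
        have : 0 ≤ (C₁ * t ^ a) ^ (2 / a - 1) := by positivity
        linarith
      · have := Real.rpow_le_rpow_of_nonpos (by positivity) (h.growth y).1 he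
        have : 0 ≤ (C₂ * t ^ a) ^ (2 / a - 1) := by positivity
        linarith
    have hn : μ⁻¹ * ‖x - y‖ = 2 / a * V y ^ (2 / a - 1) * ‖g‖ := by
      have := congrArg norm he
      rw [norm_smul, norm_smul, Real.norm_of_nonneg (by positivity),
        Real.norm_of_nonneg (by positivity)] at this
      exact this
    have hb : μ⁻¹ * ‖x - y‖ ≤ slopeBound a C₁ C₂ G * t := by
      rw [hn]
      calc 2 / a * V y ^ (2 / a - 1) * ‖g‖
          ≤ 2 / a * ((C₁ ^ (2 / a - 1) + C₂ ^ (2 / a - 1)) * t ^ (2 - a)) * (G * t ^ (a - 1)) := by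
            gcongr
        _ = slopeBound a C₁ C₂ G * (t ^ (2 - a) * t ^ (a - 1)) := by
            unfold slopeBound
            ring
        _ = slopeBound a C₁ C₂ G * t := by
            rw [← Real.rpow_add ht]
            norm_num
    rw [inv_mul_le_iff₀ hμ] at hb
    linarith

end System


/-! ### Size and drift of the smoothed Lyapunov function -/

section System

variable {m : ℕ} {V : EuclideanSpace ℝ (Fin m) → ℝ}
    {F : EuclideanSpace ℝ (Fin m) → EuclideanSpace ℝ (Fin m)} {xs : EuclideanSpace ℝ (Fin m)}
    {a c γ C C₁ C₂ G ρ μ : ℝ} {x y : EuclideanSpace ℝ (Fin m)}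

/-- The Moreau envelope of `V^{2/a}`. -/
noncomputable def envelope (V : EuclideanSpace ℝ (Fin m) → ℝ) (a μ : ℝ) :
    EuclideanSpace ℝ (Fin m) → ℝ :=
  moreauEnvelope (fun z => V z ^ (2 / a)) μ

/-- The curvature constant `G'² / C₁^{2/a}` with `G'` the gradient bound of `V^{2/a}`. -/
noncomputable def curvBound (a C₁ C₂ G : ℝ) : ℝ := slopeBound a C₁ C₂ G ^ 2 / C₁ ^ (2 / a)

theorem dac_pos (ha : 0 < a) (hc : 1 ≤ c) : 1 ≤ dac a c := by
  unfold dac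
  have : 0 ≤ a * (c - 1) / 2 := div_nonneg (mul_nonneg ha.le (by linarith)) (by norm_num)
  linarith

theorem envelopeConst_pos (hC₁ : 0 < C₁) (hμ : 0 < μ) : 0 < envelopeConst a C₁ μ := by
  unfold envelopeConst
  positivity

theorem SystemAssumptions.envelope_nonneg (h : SystemAssumptions V F xs a c γ C C₁ C₂ G ρ)
    (hC₁ : 0 < C₁) (hμ : 0 < μ) (x : EuclideanSpace ℝ (Fin m)) : 0 ≤ envelope V a μ x :=
  moreauEnvelope_nonneg (h.rpow_nonneg hC₁) hμ x

theorem SystemAssumptions.envelope_eq (h : SystemAssumptions V F xs a c γ C C₁ C₂ G ρ)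
    (hC₁ : 0 < C₁) (hμ : 0 < μ) (hx : IsProx (fun z => V z ^ (2 / a)) μ x y) :
    envelope V a μ x = V y ^ (2 / a) + ‖x - y‖ ^ 2 / (2 * μ) :=
  hx.moreauEnvelope_eq (h.rpow_nonneg hC₁) hμ

theorem SystemAssumptions.envelope_le (h : SystemAssumptions V F xs a c γ C C₁ C₂ G ρ)
    (ha : 0 < a) (hC₁ : 0 < C₁) (hC₂ : 0 < C₂) (hμ : 0 < μ) (x : EuclideanSpace ℝ (Fin m)) :
    envelope V a μ x ≤ C₂ ^ (2 / a) * ‖x - xs‖ ^ 2 := by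
  have := moreauEnvelope_le (h.rpow_nonneg hC₁) hμ x x
  simp only [sub_self, norm_zero, ne_eq, OfNat.ofNat_ne_zero, not_false_eq_true, zero_pow,
    zero_div, add_zero] at this
  exact this.trans (h.rpow_le ha hC₁ hC₂ x)

theorem SystemAssumptions.prox_le_envelope (h : SystemAssumptions V F xs a c γ C C₁ C₂ G ρ)
    (ha : 0 < a) (hC₁ : 0 < C₁) (hμ : 0 < μ) (hx : IsProx (fun z => V z ^ (2 / a)) μ x y) :
    C₁ ^ (2 / a) * ‖y - xs‖ ^ 2 ≤ envelope V a μ x := by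
  rw [h.envelope_eq hC₁ hμ hx]
  exact (h.le_rpow ha hC₁ y).trans (le_add_of_nonneg_right (by positivity))

/-- Weighted Cauchy–Schwarz for `‖x - xs‖ ≤ ‖x - y‖ + ‖y - xs‖`, with weights matching the two terms
of the envelope; this is where `κ` comes from. -/
theorem SystemAssumptions.sq_norm_le (h : SystemAssumptions V F xs a c γ C C₁ C₂ G ρ)
    (ha : 0 < a) (hC₁ : 0 < C₁) (hμ : 0 < μ) (x : EuclideanSpace ℝ (Fin m)) :
    ‖x - xs‖ ^ 2 ≤ envelopeConst a C₁ μ * envelope V a μ x := by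
  obtain ⟨y, hy⟩ := exists_isProx (h.continuous_rpow ha) (h.rpow_nonneg hC₁) hμ x
  have hP : 0 < C₁ ^ (2 / a) := by positivity
  have h1 : C₁ ^ (2 / a) * ‖y - xs‖ ^ 2 + ‖x - y‖ ^ 2 / (2 * μ) ≤ envelope V a μ x := by
    rw [h.envelope_eq hC₁ hμ hy]
    have := h.le_rpow ha hC₁ y
    linarith
  refine le_trans ?_ (mul_le_mul_of_nonneg_left h1 (envelopeConst_pos hC₁ hμ).le)
  have h2 : ‖x - xs‖ ≤ ‖x - y‖ + ‖y - xs‖ := norm_sub_le_norm_sub_add_norm_sub x y xs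
  have h3 : ‖x - xs‖ ^ 2 ≤ (‖x - y‖ + ‖y - xs‖) ^ 2 := by gcongr
  refine h3.trans ?_
  unfold envelopeConst
  set P := C₁ ^ (2 / a)
  set s := ‖x - y‖
  set t := ‖y - xs‖
  have : (1 / P + 2 * μ) * (P * t ^ 2 + s ^ 2 / (2 * μ)) - (s + t) ^ 2
      = (s - 2 * μ * P * t) ^ 2 / (2 * μ * P) := by
    field_simp
    ring
  have h4 : 0 ≤ (s - 2 * μ * P * t) ^ 2 / (2 * μ * P) := by positivity
  linarith

theorem SystemAssumptions.sq_norm_sub_prox_le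
    (h : SystemAssumptions V F xs a c γ C C₁ C₂ G ρ) (ha : 0 < a) (hC₁ : 0 < C₁) (hC₂ : 0 < C₂)
    (hG : 0 < G) (hμ : 0 < μ) (hx : IsProx (fun z => V z ^ (2 / a)) μ x y) :
    ‖x - y‖ ^ 2 ≤ μ ^ 2 * curvBound a C₁ C₂ G * envelope V a μ x := by
  have h1 := h.norm_sub_prox_le ha hC₁ hC₂ hG hμ hx
  have h2 := h.prox_le_envelope ha hC₁ hμ hx
  have hP : 0 < C₁ ^ (2 / a) := by positivity
  calc ‖x - y‖ ^ 2 ≤ (μ * slopeBound a C₁ C₂ G * ‖y - xs‖) ^ 2 := by gcongr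
    _ = μ ^ 2 * curvBound a C₁ C₂ G * (C₁ ^ (2 / a) * ‖y - xs‖ ^ 2) := by
        unfold curvBound
        field_simp
    _ ≤ μ ^ 2 * curvBound a C₁ C₂ G * envelope V a μ x := by
        refine mul_le_mul_of_nonneg_left h2 ?_
        unfold curvBound
        positivity

/-- Decreasing the smoothing parameter increases the envelope by a small factor only. -/
theorem SystemAssumptions.envelope_le_of_le
    (h : SystemAssumptions V F xs a c γ C C₁ C₂ G ρ) (ha : 0 < a) (hC₁ : 0 < C₁) (hC₂ : 0 < C₂)
    (hG : 0 < G) {μ' : ℝ} (hμ' : 0 < μ') (hle : μ' ≤ μ) (x : EuclideanSpace ℝ (Fin m)) :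
    envelope V a μ' x
      ≤ (1 + curvBound a C₁ C₂ G / 2 * μ * (μ / μ' - 1)) * envelope V a μ x := by
  have hμ : 0 < μ := hμ'.trans_le hle
  -- The minimizer for the larger parameter is the competitor for the smaller one.
  obtain ⟨y, hy⟩ := exists_isProx (h.continuous_rpow ha) (h.rpow_nonneg hC₁) hμ x
  have h1 : envelope V a μ' x ≤ V y ^ (2 / a) + ‖x - y‖ ^ 2 / (2 * μ') :=
    moreauEnvelope_le (h.rpow_nonneg hC₁) hμ' x y
  have h2 := h.envelope_eq hC₁ hμ hy
  have h3 := h.sq_norm_sub_prox_le ha hC₁ hC₂ hG hμ hy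
  have h4 : (0 : ℝ) ≤ (μ / μ' - 1) / (2 * μ) := by
    refine div_nonneg ?_ (by positivity)
    rw [sub_nonneg, one_le_div hμ']
    exact hle
  have h5 := mul_le_mul_of_nonneg_right h3 h4
  have e1 : ‖x - y‖ ^ 2 / (2 * μ')
      = ‖x - y‖ ^ 2 / (2 * μ) + ‖x - y‖ ^ 2 * ((μ / μ' - 1) / (2 * μ)) := by
    field_simp
    ring
  have e2 : μ ^ 2 * curvBound a C₁ C₂ G * envelope V a μ x * ((μ / μ' - 1) / (2 * μ))
      = curvBound a C₁ C₂ G / 2 * μ * (μ / μ' - 1) * envelope V a μ x := by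
    field_simp
  linarith

/-- Stability acts at the proximal point, so its decrease must be expressed through the envelope at
`x`. The comparison passes through `‖x - xs‖ ≤ (1 + μ S)‖y - xs‖`, with `S` the slope bound, and the
two growth bounds. -/
theorem SystemAssumptions.le_rpow_prox
    (h : SystemAssumptions V F xs a c γ C C₁ C₂ G ρ) (ha : 0 < a) (hC₁ : 0 < C₁) (hC₂ : 0 < C₂)
    (hG : 0 < G) (hμ : 0 < μ) (hx : IsProx (fun z => V z ^ (2 / a)) μ x y) :
    (C₁ / C₂) ^ (2 / a) / (1 + μ * slopeBound a C₁ C₂ G) ^ 2 * envelope V a μ x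
      ≤ V y ^ (2 / a) := by
  have hS := slopeBound_pos ha hC₁ hC₂ hG
  have h1 := h.norm_sub_prox_le ha hC₁ hC₂ hG hμ hx
  have h2 : ‖x - xs‖ ≤ (1 + μ * slopeBound a C₁ C₂ G) * ‖y - xs‖ := by
    linarith [norm_sub_le_norm_sub_add_norm_sub x y xs]
  have h3 := h.envelope_le ha hC₁ hC₂ hμ x
  refine le_trans ?_ (h.le_rpow ha hC₁ y)
  have h4 : envelope V a μ x
      ≤ C₂ ^ (2 / a) * ((1 + μ * slopeBound a C₁ C₂ G) * ‖y - xs‖) ^ 2 :=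
    h3.trans (by gcongr)
  refine (mul_le_mul_of_nonneg_left h4 (by positivity)).trans (le_of_eq ?_)
  rw [Real.div_rpow hC₁.le hC₂.le]
  have : 0 < C₂ ^ (2 / a) := by positivity
  field_simp

/-- The drift conditions hold only in the ball of radius `ρ`; the gap `ρ - r` absorbs the
displacement when `μ` is small. -/
theorem SystemAssumptions.norm_prox_le
    (h : SystemAssumptions V F xs a c γ C C₁ C₂ G ρ) (ha : 0 < a) (hC₁ : 0 < C₁) (hC₂ : 0 < C₂)
    (hG : 0 < G) (hμ : 0 < μ) (hxs : ‖xs‖ ≤ ρ) {r : ℝ} (hr : r < ρ)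
    (hsmall : μ * (slopeBound a C₁ C₂ G * (√((C₂ / C₁) ^ (2 / a)) * (2 * ρ))) ≤ ρ - r)
    (hxr : ‖x‖ ≤ r) (hx : IsProx (fun z => V z ^ (2 / a)) μ x y) : ‖y‖ ≤ ρ := by
  have hS := slopeBound_pos ha hC₁ hC₂ hG
  have hρ : 0 ≤ ρ := (norm_nonneg xs).trans hxs
  have hxx : ‖x - xs‖ ≤ 2 * ρ := by linarith [norm_sub_le x xs]
  have h1 := h.norm_sub_prox_le ha hC₁ hC₂ hG hμ hx
  have h2 := (h.prox_le_envelope ha hC₁ hμ hx).trans (h.envelope_le ha hC₁ hC₂ hμ x)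
  have hP : 0 < C₁ ^ (2 / a) := by positivity
  have h3 : ‖y - xs‖ ^ 2 ≤ (√((C₂ / C₁) ^ (2 / a)) * (2 * ρ)) ^ 2 := by
    rw [mul_pow, Real.sq_sqrt (by positivity), Real.div_rpow hC₂.le hC₁.le, div_mul_eq_mul_div,
      le_div_iff₀ hP, mul_comm]
    exact h2.trans (by gcongr)
  have h4 : ‖y - xs‖ ≤ √((C₂ / C₁) ^ (2 / a)) * (2 * ρ) :=
    abs_le_of_sq_le_sq' h3 (by positivity) |>.2
  have h5 : ‖x - y‖ ≤ μ * (slopeBound a C₁ C₂ G * (√((C₂ / C₁) ^ (2 / a)) * (2 * ρ))) := by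
    refine h1.trans ?_
    rw [mul_assoc]
    gcongr
  have h6 : ‖y‖ ≤ ‖x‖ + ‖x - y‖ := by
    have := norm_sub_le x (x - y)
    rwa [sub_sub_cancel] at this
  linarith

/-- The exponents combine as `(2/a - 1) + c = (2/a) d_{a,c}`, which explains `d_{a,c}`. At `y = xs`
both sides vanish. -/
theorem SystemAssumptions.inner_prox_le
    (h : SystemAssumptions V F xs a c γ C C₁ C₂ G ρ) (ha : 0 < a) (hc : 1 ≤ c)
    (hC₁ : 0 < C₁) (hC₂ : 0 < C₂) (hμ : 0 < μ)
    (hy : ‖y‖ ≤ ρ) (hx : IsProx (fun z => V z ^ (2 / a)) μ x y) :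
    inner ℝ (x - y) (F y) / μ ≤ -(2 * γ / a) * (V y ^ (2 / a)) ^ dac a c := by
  by_cases hys : y = xs
  · subst hys
    have hD := dac_pos ha hc
    rw [h.stationary, inner_zero_right, zero_div, h.apply_stationary ha,
      Real.zero_rpow (by positivity), Real.zero_rpow (by linarith), mul_zero]
  · obtain ⟨g, hg, he⟩ := h.exists_mem_clarkeGradient ha hC₁ hμ hx hys
    have hVy := h.pos hC₁ hys
    have h1 : inner ℝ (x - y) (F y) / μ = 2 / a * V y ^ (2 / a - 1) * inner ℝ g (F y) := by
      rw [← real_inner_smul_left, ← he, real_inner_smul_left]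
      field_simp
    rw [h1]
    have h2 := mul_le_mul_of_nonneg_left (h.stability y hy g hg)
      (by positivity : 0 ≤ 2 / a * V y ^ (2 / a - 1))
    refine h2.trans (le_of_eq ?_)
    rw [← Real.rpow_mul hVy.le, show 2 / a * dac a c = (2 / a - 1) + c by
      unfold dac
      field_simp
      ring, Real.rpow_add hVy]
    ring

/-- One step along the drift decreases the envelope, up to an error that is linear in the
envelope. -/
theorem SystemAssumptions.envelope_drift_le
    (h : SystemAssumptions V F xs a c γ C C₁ C₂ G ρ) (ha : 0 < a) (hc : 1 ≤ c) (hγ : 0 < γ)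
    (hC : 0 < C) (hC₁ : 0 < C₁) (hC₂ : 0 < C₂)
    (hG : 0 < G) (hμ : 0 < μ) (hxs : ‖xs‖ ≤ ρ) {r α : ℝ} (hα : 0 < α) (hr : r < ρ)
    (hsmall : μ * (slopeBound a C₁ C₂ G * (√((C₂ / C₁) ^ (2 / a)) * (2 * ρ))) ≤ ρ - r)
    (hxr : ‖x‖ ≤ r) :
    envelope V a μ (x + α • F x) ≤ envelope V a μ x
      - α * (2 * γ / a) * ((C₁ / C₂) ^ (2 / a) / (1 + μ * slopeBound a C₁ C₂ G) ^ 2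
          * envelope V a μ x) ^ dac a c
      + (α * C * μ * curvBound a C₁ C₂ G + α ^ 2 * C ^ 2 * envelopeConst a C₁ μ / (2 * μ))
          * envelope V a μ x := by
  obtain ⟨y, hy⟩ := exists_isProx (h.continuous_rpow ha) (h.rpow_nonneg hC₁) hμ x
  have hyρ := h.norm_prox_le ha hC₁ hC₂ hG hμ hxs hr hsmall hxr hy
  have h1 : envelope V a μ (x + α • F x) ≤ _ :=
    hy.moreauEnvelope_add_le (h.rpow_nonneg hC₁) hμ (α • F x)
  have h2 := h.inner_prox_le ha hc hC₁ hC₂ hμ hyρ hy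
  have h3 := h.sq_norm_sub_prox_le ha hC₁ hC₂ hG hμ hy
  have h4 := h.le_rpow_prox ha hC₁ hC₂ hG hμ hy
  have h5 := h.sq_norm_le ha hC₁ hμ x
  have hM := h.envelope_nonneg hC₁ hμ x
  have hD := dac_pos ha hc
  have h6 := Real.rpow_le_rpow (mul_nonneg (by positivity) hM) h4 (by linarith : 0 ≤ dac a c)
  have hxρ : ‖x‖ ≤ ρ := hxr.trans hr.le
  have h7 : ‖F x‖ ^ 2 ≤ C ^ 2 * ‖x - xs‖ ^ 2 := by
    have := h.lipschitz x xs hxρ hxs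
    rw [h.stationary, sub_zero] at this
    rw [← mul_pow]
    gcongr
  -- Stability is known against Clarke gradients at `y`, so the drift is moved from `x` to `y` by
  -- the Lipschitz bound.
  have h8 : inner ℝ (x - y) (F x) ≤ inner ℝ (x - y) (F y) + C * ‖x - y‖ ^ 2 := by
    have e : inner ℝ (x - y) (F x) = inner ℝ (x - y) (F y) + inner ℝ (x - y) (F x - F y) := by
      rw [← inner_add_right, add_sub_cancel]
    have := real_inner_le_norm (x - y) (F x - F y)
    have h9 := mul_le_mul_of_nonneg_left (h.lipschitz x y hxρ hyρ) (norm_nonneg (x - y))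
    nlinarith
  change _ ≤ envelope V a μ x + _ + _ at h1
  refine h1.trans ?_
  rw [real_inner_smul_right, norm_smul, mul_pow, Real.norm_of_nonneg hα.le]
  have h10 : inner ℝ (x - y) (F x) / μ
      ≤ -(2 * γ / a) * (V y ^ (2 / a)) ^ dac a c + C * μ * curvBound a C₁ C₂ G * envelope V a μ x := by
    have e1 : (inner ℝ (x - y) (F y) + C * ‖x - y‖ ^ 2) / μ
        ≤ (inner ℝ (x - y) (F y)
          + C * (μ ^ 2 * curvBound a C₁ C₂ G * envelope V a μ x)) / μ := by gcongr
    have e2 : (inner ℝ (x - y) (F y)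
          + C * (μ ^ 2 * curvBound a C₁ C₂ G * envelope V a μ x)) / μ
        = inner ℝ (x - y) (F y) / μ + C * μ * curvBound a C₁ C₂ G * envelope V a μ x := by
      field_simp
    have e3 : inner ℝ (x - y) (F x) / μ ≤ (inner ℝ (x - y) (F y) + C * ‖x - y‖ ^ 2) / μ := by
      gcongr
    linarith
  have h11 : α * inner ℝ (x - y) (F x) / μ ≤ α * (-(2 * γ / a) *
      ((C₁ / C₂) ^ (2 / a) / (1 + μ * slopeBound a C₁ C₂ G) ^ 2 * envelope V a μ x) ^ dac a c
        + C * μ * curvBound a C₁ C₂ G * envelope V a μ x) := by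
    rw [mul_div_assoc]
    refine mul_le_mul_of_nonneg_left (h10.trans ?_) hα.le
    have : 0 ≤ 2 * γ / a := by positivity
    nlinarith
  have h12 : α ^ 2 * ‖F x‖ ^ 2 / (2 * μ)
      ≤ α ^ 2 * (C ^ 2 * (envelopeConst a C₁ μ * envelope V a μ x)) / (2 * μ) := by
    gcongr
    exact h7.trans (by gcongr)
  have e : α ^ 2 * (C ^ 2 * (envelopeConst a C₁ μ * envelope V a μ x)) / (2 * μ)
      = α ^ 2 * C ^ 2 * envelopeConst a C₁ μ / (2 * μ) * envelope V a μ x := by ring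
  linarith

end System


/-! ### Effect of the noise on the mean envelope -/

section NoiseStep

variable {m : ℕ} {V : EuclideanSpace ℝ (Fin m) → ℝ}
    {F : EuclideanSpace ℝ (Fin m) → EuclideanSpace ℝ (Fin m)} {xs : EuclideanSpace ℝ (Fin m)}
    {a c γ C C₁ C₂ G ρ μ : ℝ} {Ω : Type*} {x w : ℕ → Ω → EuclideanSpace ℝ (Fin m)} {step : ℕ → ℝ} {A B r : ℝ}

theorem measurable_history (k : ℕ) : Measurable[history x w k] (x k) := by
  rw [measurable_iff_comap_le]
  exact le_sup_of_le_left (le_iSup₂_of_le k (Set.mem_Iic.2 le_rfl) le_rfl)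

variable [mΩ : MeasurableSpace Ω] {P : Measure Ω}

theorem integrable_comp_of_norm_le [IsFiniteMeasure P] {g : EuclideanSpace ℝ (Fin m) → ℝ}
    (hg : Continuous g) {X : Ω → EuclideanSpace ℝ (Fin m)} (hX : AEStronglyMeasurable X P) {R : ℝ}
    (hR : ∀ᵐ ω ∂P, ‖X ω‖ ≤ R) : Integrable (fun ω => g (X ω)) P := by
  obtain ⟨b, hb⟩ := (isCompact_closedBall (0 : EuclideanSpace ℝ (Fin m)) R).exists_bound_of_continuousOn
    hg.continuousOn
  refine Integrable.of_bound (C := b) (hg.comp_aestronglyMeasurable hX) ?_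
  filter_upwards [hR] with ω hω
  exact hb _ (by simpa using hω)

theorem IsTrajectory.history_le (hT : IsTrajectory P F step A B r x w) (k : ℕ) :
    history x w k ≤ mΩ :=
  sup_le (iSup₂_le fun j _ => (hT.measurable_x j).comap_le)
    (iSup₂_le fun j _ => (hT.measurable_w j).comap_le)

theorem IsTrajectory.integral_sq_noise_le [IsProbabilityMeasure P]
    (hT : IsTrajectory P F step A B r x w) (k : ℕ) :
    ∫ ω, ‖w k ω‖ ^ 2 ∂P ≤ A + B * ∫ ω, ‖x k ω‖ ^ 2 ∂P := by
  have hx : Integrable (fun ω => ‖x k ω‖ ^ 2) P :=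
    integrable_comp_of_norm_le (g := fun z => ‖z‖ ^ 2) (by fun_prop)
      (hT.measurable_x k).aestronglyMeasurable (hT.bounded k)
  rw [← integral_condExp (hT.history_le k)]
  have hi : Integrable (fun ω => A + B * ‖x k ω‖ ^ 2) P :=
    (integrable_const A).add (hx.const_mul B)
  refine (integral_mono_ae integrable_condExp hi (hT.variance k)).trans (le_of_eq ?_)
  rw [integral_add (integrable_const A) (hx.const_mul B), integral_const_mul]
  simp

/-- The noise increases the expected envelope by at most a multiple of its second moment. -/
theorem IsTrajectory.integral_envelope_le [IsProbabilityMeasure P]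
    (hT : IsTrajectory P F step A B r x w) (h : SystemAssumptions V F xs a c γ C C₁ C₂ G ρ)
    (ha : 0 < a) (hC : 0 < C) (hC₁ : 0 < C₁) (hμ : 0 < μ) (hxs : ‖xs‖ ≤ ρ) (hr : r < ρ) (k : ℕ)
    {U : EuclideanSpace ℝ (Fin m) → ℝ} (hU : Continuous U)
    (hdrift : ∀ z, ‖z‖ ≤ r → envelope V a μ (z + step k • F z) ≤ U z) :
    ∫ ω, envelope V a μ (x (k + 1) ω) ∂P ≤ ∫ ω, U (x k ω) ∂P
      + step k ^ 2 / (2 * μ) * (A + B * ∫ ω, ‖x k ω‖ ^ 2 ∂P) := by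
  set α := step k with hα
  set M := envelope V a μ with hM
  have hMc : Continuous M := continuous_moreauEnvelope (h.continuous_rpow ha) (h.rpow_nonneg hC₁) hμ
  have hm := hT.history_le k
  -- the drift cut off outside the ball
  have hFc : ContinuousOn F (Metric.closedBall 0 ρ) := by
    refine (LipschitzOnWith.of_dist_le_mul (K := ⟨C, hC.le⟩) fun z hz z' hz' => ?_).continuousOn
    rw [dist_eq_norm, dist_eq_norm]
    exact h.lipschitz z z' (by simpa using hz) (by simpa using hz')
  classical
  -- Nothing makes `F` measurable outside the ball, which the iterates almost surely avoid.
  let F' : EuclideanSpace ℝ (Fin m) → EuclideanSpace ℝ (Fin m) :=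
    (Metric.closedBall 0 ρ).piecewise F 0
  have hF'm : Measurable F' :=
    hFc.measurable_piecewise continuousOn_const Metric.isClosed_closedBall.measurableSet
  have hF' : ∀ z, ‖z‖ ≤ r → F' z = F z := fun z hz =>
    Set.piecewise_eq_of_mem _ _ _ (by simpa using hz.trans hr.le)
  let Z : Ω → EuclideanSpace ℝ (Fin m) := fun ω => x k ω + α • F' (x k ω)
  have hZm : StronglyMeasurable[history x w k] Z := by
    have hx := measurable_history (x := x) (w := w) k
    exact (hx.add ((hF'm.comp hx).const_smul α)).stronglyMeasurable
  have hZm0 : AEStronglyMeasurable Z P := (hZm.mono hm).aestronglyMeasurable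
  have hZb : ∀ᵐ ω ∂P, ‖Z ω‖ ≤ r + |α| * (C * (ρ + ρ)) := by
    filter_upwards [hT.bounded k] with ω hω
    have h1 := h.lipschitz (x k ω) xs (hω.trans hr.le) hxs
    rw [h.stationary, sub_zero] at h1
    have h2 : ‖x k ω - xs‖ ≤ ρ + ρ := by linarith [norm_sub_le (x k ω) xs]
    have h3 : ‖F (x k ω)‖ ≤ C * (ρ + ρ) := h1.trans (by gcongr)
    simp only [Z]
    rw [hF' _ hω]
    refine (norm_add_le _ _).trans (add_le_add hω ?_)
    rw [norm_smul, Real.norm_eq_abs]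
    gcongr
  have hZint : Integrable Z P := Integrable.of_bound hZm0 _ hZb
  have hwint : Integrable (w k) P := (hT.memLp_w k).integrable (by norm_num)
  have hw2 : Integrable (fun ω => ‖w k ω‖ ^ 2) P := (hT.memLp_w k).integrable_norm_pow (by norm_num)
  let Y : Ω → EuclideanSpace ℝ (Fin m) := Z + α • w k
  have hYx : x (k + 1) =ᵐ[P] Y := by
    filter_upwards [hT.update k, hT.bounded k] with ω h1 h2
    simp only [Y, Z, Pi.add_apply, Pi.smul_apply]
    rw [h1, hF' _ h2, smul_add, add_assoc]
  have hYint : Integrable Y P := hZint.add (hwint.smul α)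
  have hYcond : P[Y | history x w k] =ᵐ[P] Z := by
    have h1 := condExp_add hZint (hwint.smul α) (history x w k)
    have h2 := condExp_smul (μ := P) α (w k) (history x w k)
    rw [condExp_of_stronglyMeasurable hm hZm hZint] at h1
    filter_upwards [h1, h2, hT.unbiased k] with ω h1 h2 h3
    rw [h1, Pi.add_apply, h2, Pi.smul_apply, h3]
    simp
  -- conditional Jensen for the convex part of the envelope
  let f : EuclideanSpace ℝ (Fin m) → ℝ := fun z => ‖z‖ ^ 2 / (2 * μ) - M z
  have hfc : Continuous f := by fun_prop
  have hfconv : ConvexOn ℝ Set.univ f :=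
    convexOn_sub_moreauEnvelope (h.continuous_rpow ha) (h.rpow_nonneg hC₁) hμ
  have hx1 := (hT.measurable_x (k + 1)).aestronglyMeasurable (μ := P)
  have hfx : Integrable (fun ω => f (x (k + 1) ω)) P :=
    integrable_comp_of_norm_le hfc hx1 (hT.bounded (k + 1))
  have hfY : Integrable (f ∘ Y) P := hfx.congr (hYx.fun_comp f)
  have hfZ : Integrable (fun ω => f (Z ω)) P := integrable_comp_of_norm_le hfc hZm0 hZb
  have hjensen : ∫ ω, f (Z ω) ∂P ≤ ∫ ω, f (x (k + 1) ω) ∂P := by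
    have h1 := hfconv.map_condExp_le_univ (μ := P) hm hfc.lowerSemicontinuous hYint hfY
    have h2 : ∫ ω, f (x (k + 1) ω) ∂P = ∫ ω, (P[f ∘ Y | history x w k]) ω ∂P := by
      rw [integral_condExp hm]
      exact integral_congr_ae (hYx.fun_comp f)
    rw [h2]
    refine integral_mono_ae hfZ integrable_condExp ?_
    filter_upwards [h1, hYcond] with ω h1 h2
    rw [← h2]
    exact h1
  -- the second moment
  have hcrossint : Integrable (fun ω => inner ℝ (Z ω) (w k ω)) P := by
    refine (hwint.norm.const_mul (r + |α| * (C * (ρ + ρ)))).mono'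
      (hZm0.inner hwint.aestronglyMeasurable) ?_
    filter_upwards [hZb] with ω hω
    exact (norm_inner_le_norm _ _).trans (by gcongr)
  have hcross : ∫ ω, inner ℝ (Z ω) (w k ω) ∂P = 0 := by
    rw [← integral_condExp hm]
    have h1 := condExp_bilin_of_stronglyMeasurable_left (m := history x w k) (μ := P) (innerSL ℝ) hZm
      (g := w k) hcrossint hwint
    have h2 : P[fun ω => inner ℝ (Z ω) (w k ω) | history x w k] =ᵐ[P] 0 := by
      refine h1.trans ?_
      filter_upwards [hT.unbiased k] with ω hω
      simp [hω]
    rw [integral_congr_ae h2]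
    simp
  have hZ2 : Integrable (fun ω => ‖Z ω‖ ^ 2) P :=
    integrable_comp_of_norm_le (g := fun z => ‖z‖ ^ 2) (by fun_prop) hZm0 hZb
  have hsq : ∫ ω, ‖x (k + 1) ω‖ ^ 2 ∂P = ∫ ω, ‖Z ω‖ ^ 2 ∂P + α ^ 2 * ∫ ω, ‖w k ω‖ ^ 2 ∂P := by
    have h1 : (fun ω => ‖x (k + 1) ω‖ ^ 2) =ᵐ[P]
        fun ω => (‖Z ω‖ ^ 2 + 2 * α * inner ℝ (Z ω) (w k ω)) + α ^ 2 * ‖w k ω‖ ^ 2 := by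
      filter_upwards [hYx] with ω hω
      rw [hω]
      simp only [Y, Pi.add_apply, Pi.smul_apply]
      rw [norm_add_sq_real, real_inner_smul_right, norm_smul, mul_pow, Real.norm_eq_abs, sq_abs]
      ring
    have h2 : Integrable (fun ω => ‖Z ω‖ ^ 2 + 2 * α * inner ℝ (Z ω) (w k ω)) P :=
      hZ2.add (hcrossint.const_mul _)
    rw [integral_congr_ae h1, integral_add h2 (hw2.const_mul _),
      integral_add hZ2 (hcrossint.const_mul _), integral_const_mul, integral_const_mul, hcross]
    ring
  have hx2 : Integrable (fun ω => ‖x (k + 1) ω‖ ^ 2) P :=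
    integrable_comp_of_norm_le (g := fun z => ‖z‖ ^ 2) (by fun_prop) hx1 (hT.bounded (k + 1))
  have hMZ : Integrable (fun ω => M (Z ω)) P := integrable_comp_of_norm_le hMc hZm0 hZb
  have hMx : Integrable (fun ω => M (x (k + 1) ω)) P :=
    integrable_comp_of_norm_le hMc hx1 (hT.bounded (k + 1))
  have hUx : Integrable (fun ω => U (x k ω)) P :=
    integrable_comp_of_norm_le hU (hT.measurable_x k).aestronglyMeasurable (hT.bounded k)
  have hMU : ∫ ω, M (Z ω) ∂P ≤ ∫ ω, U (x k ω) ∂P := by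
    refine integral_mono_ae hMZ hUx ?_
    filter_upwards [hT.bounded k] with ω hω
    simp only [Z]
    rw [hF' _ hω]
    exact hdrift _ hω
  have e1 : ∫ ω, f (Z ω) ∂P = (∫ ω, ‖Z ω‖ ^ 2 ∂P) / (2 * μ) - ∫ ω, M (Z ω) ∂P := by
    rw [← integral_div, ← integral_sub (hZ2.div_const _) hMZ]
  have e2 : ∫ ω, f (x (k + 1) ω) ∂P
      = (∫ ω, ‖x (k + 1) ω‖ ^ 2 ∂P) / (2 * μ) - ∫ ω, M (x (k + 1) ω) ∂P := by
    rw [← integral_div, ← integral_sub (hx2.div_const _) hMx]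
  have hn := mul_le_mul_of_nonneg_left (hT.integral_sq_noise_le k)
    (by positivity : 0 ≤ α ^ 2 / (2 * μ))
  -- The terms `𝔼‖Z‖²/(2μ)` cancel, and only the second moment of the noise is left.
  rw [e1, e2, hsq] at hjensen
  have e3 : (∫ ω, ‖Z ω‖ ^ 2 ∂P + α ^ 2 * ∫ ω, ‖w k ω‖ ^ 2 ∂P) / (2 * μ)
      = (∫ ω, ‖Z ω‖ ^ 2 ∂P) / (2 * μ) + α ^ 2 / (2 * μ) * ∫ ω, ‖w k ω‖ ^ 2 ∂P := by ring
  rw [e3] at hjensen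
  linarith


end NoiseStep

/-! ### From superlinear decrease to linear contraction -/

/-- A power of exponent `D ≥ 1` lies above its tangents. -/
theorem tangent_le_rpow {D s ε : ℝ} (hD : 1 ≤ D) (hs : 0 ≤ s) (hε : 0 < ε) :
    D * ε ^ (D - 1) * s - (D - 1) * ε ^ D ≤ s ^ D := by
  have h1 := one_add_mul_self_le_rpow_one_add (s := s / ε - 1) (p := D)
    (by linarith [div_nonneg hs hε.le]) hD
  rw [add_sub_cancel, Real.div_rpow hs hε.le, le_div_iff₀ (by positivity)] at h1
  refine le_trans (le_of_eq ?_) h1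
  rw [Real.rpow_sub hε, Real.rpow_one]
  field_simp
  ring

/-- The tangent is taken at `(α n / ν)^{1/D}`. This point makes `α ν ε^D` equal to `α² n`, so that
the loss from linearizing has the size of the noise. -/
theorem contraction_le_rpow {D α ν n s : ℝ} (hD : 1 ≤ D) (hα : 0 < α) (hν : 0 < ν) (hn : 0 < n)
    (hs : 0 ≤ s) :
    D * α ^ (2 - 1 / D) * ν ^ (1 / D) * n ^ (1 - 1 / D) * s - (D - 1) * α ^ 2 * n
      ≤ α * ν * s ^ D := by
  have hD0 : D ≠ 0 := by linarith
  have hb : 0 < α * n / ν := by positivity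
  have h1 := tangent_le_rpow hD hs (Real.rpow_pos_of_pos hb (1 / D))
  rw [← Real.rpow_mul hb.le, ← Real.rpow_mul hb.le, one_div_mul_cancel hD0, Real.rpow_one,
    show 1 / D * (D - 1) = 1 - 1 / D by field_simp] at h1
  have h2 := mul_le_mul_of_nonneg_left h1 (by positivity : 0 ≤ α * ν)
  refine le_trans (le_of_eq ?_) h2
  have e1 : α * ν * (α * n / ν) ^ (1 - 1 / D)
      = α ^ (2 - 1 / D) * ν ^ (1 / D) * n ^ (1 - 1 / D) := by
    rw [Real.div_rpow (by positivity) hν.le, Real.mul_rpow hα.le hn.le,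
      show 2 - 1 / D = 1 + (1 - 1 / D) by ring, Real.rpow_add hα, Real.rpow_one,
      Real.rpow_sub hν 1 (1 / D), Real.rpow_one]
    have : 0 < ν ^ (1 / D) := by positivity
    field_simp
  have e2 : α * ν * (α * n / ν) = α ^ 2 * n := by field_simp
  calc _ = D * (α * ν * (α * n / ν) ^ (1 - 1 / D)) * s - (D - 1) * (α * ν * (α * n / ν)) := by
        rw [e1, e2]
        ring
    _ = _ := by ring

section Contraction

variable {m : ℕ} {V : EuclideanSpace ℝ (Fin m) → ℝ}
    {F : EuclideanSpace ℝ (Fin m) → EuclideanSpace ℝ (Fin m)} {xs : EuclideanSpace ℝ (Fin m)}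
    {a c γ C C₁ C₂ G ρ μ : ℝ} {Ω : Type*} [mΩ : MeasurableSpace Ω] {P : Measure Ω}
    {step : ℕ → ℝ} {A B r : ℝ} {x w : ℕ → Ω → EuclideanSpace ℝ (Fin m)}

theorem IsTrajectory.integrable_envelope [IsProbabilityMeasure P]
    (hT : IsTrajectory P F step A B r x w) (h : SystemAssumptions V F xs a c γ C C₁ C₂ G ρ)
    (ha : 0 < a) (hC₁ : 0 < C₁) (hμ : 0 < μ) (k : ℕ) :
    Integrable (fun ω => envelope V a μ (x k ω)) P :=
  integrable_comp_of_norm_le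
    (continuous_moreauEnvelope (h.continuous_rpow ha) (h.rpow_nonneg hC₁) hμ)
    (hT.measurable_x k).aestronglyMeasurable (hT.bounded k)

theorem IsTrajectory.integrable_sq_norm_sub [IsProbabilityMeasure P]
    (hT : IsTrajectory P F step A B r x w) (xs : EuclideanSpace ℝ (Fin m)) (k : ℕ) :
    Integrable (fun ω => ‖x k ω - xs‖ ^ 2) P :=
  integrable_comp_of_norm_le (g := fun z => ‖z - xs‖ ^ 2) (by fun_prop)
    (hT.measurable_x k).aestronglyMeasurable (hT.bounded k)

theorem IsTrajectory.mse_le [IsProbabilityMeasure P]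
    (hT : IsTrajectory P F step A B r x w) (h : SystemAssumptions V F xs a c γ C C₁ C₂ G ρ)
    (ha : 0 < a) (hC₁ : 0 < C₁) (hμ : 0 < μ) (k : ℕ) :
    mse P x xs k ≤ envelopeConst a C₁ μ * ∫ ω, envelope V a μ (x k ω) ∂P := by
  rw [← integral_const_mul]
  exact integral_mono (hT.integrable_sq_norm_sub xs k)
    ((hT.integrable_envelope h ha hC₁ hμ k).const_mul _) fun ω => h.sq_norm_le ha hC₁ hμ _

theorem IsTrajectory.integral_envelope_le_mse [IsProbabilityMeasure P]
    (hT : IsTrajectory P F step A B r x w) (h : SystemAssumptions V F xs a c γ C C₁ C₂ G ρ)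
    (ha : 0 < a) (hC₁ : 0 < C₁) (hC₂ : 0 < C₂) (hμ : 0 < μ) (k : ℕ) :
    ∫ ω, envelope V a μ (x k ω) ∂P ≤ mse P x xs k * C₂ ^ (2 / a) := by
  rw [mul_comm, mse, ← integral_const_mul]
  exact integral_mono (hT.integrable_envelope h ha hC₁ hμ k)
    ((hT.integrable_sq_norm_sub xs k).const_mul _) fun ω => h.envelope_le ha hC₁ hC₂ hμ _

theorem IsTrajectory.integral_envelope_le_of_le [IsProbabilityMeasure P]
    (hT : IsTrajectory P F step A B r x w) (h : SystemAssumptions V F xs a c γ C C₁ C₂ G ρ)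
    (ha : 0 < a) (hC₁ : 0 < C₁) (hC₂ : 0 < C₂) (hG : 0 < G) {μ' : ℝ} (hμ' : 0 < μ') (hle : μ' ≤ μ)
    (k : ℕ) :
    ∫ ω, envelope V a μ' (x k ω) ∂P ≤ (1 + curvBound a C₁ C₂ G / 2 * μ * (μ / μ' - 1)) *
      ∫ ω, envelope V a μ (x k ω) ∂P := by
  rw [← integral_const_mul]
  exact integral_mono (hT.integrable_envelope h ha hC₁ hμ' k)
    ((hT.integrable_envelope h ha hC₁ (hμ'.trans_le hle) k).const_mul _) fun ω =>
      h.envelope_le_of_le ha hC₁ hC₂ hG hμ' hle _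

/-- The rate at which one step of size `α` contracts the mean envelope, up to a factor `2`. -/
noncomputable def stepRate (D α ν n : ℝ) : ℝ :=
  1 / 2 * D * α ^ (2 - 1 / D) * ν ^ (1 / D) * n ^ (1 - 1 / D)

/-- One step of stochastic approximation contracts the mean envelope, up to noise. -/
theorem IsTrajectory.integral_envelope_contraction [IsProbabilityMeasure P]
    (hT : IsTrajectory P F step A B r x w) (h : SystemAssumptions V F xs a c γ C C₁ C₂ G ρ)
    (ha : 0 < a) (hc : 1 ≤ c) (hγ : 0 < γ) (hC : 0 < C) (hC₁ : 0 < C₁) (hC₂ : 0 < C₂)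
    (hG : 0 < G) (hB : 0 ≤ B) (hμ : 0 < μ) (hxs : ‖xs‖ ≤ ρ) (hr : r < ρ) (k : ℕ)
    (hα : 0 < step k)
    (hsmall : μ * (slopeBound a C₁ C₂ G * (√((C₂ / C₁) ^ (2 / a)) * (2 * ρ))) ≤ ρ - r)
    {ν n : ℝ} (hν : 0 < ν) (hn : 0 < n)
    (hνle : 3 / 4 * ν ≤ 2 * γ / a
      * ((C₁ / C₂) ^ (2 / a) / (1 + μ * slopeBound a C₁ C₂ G) ^ 2) ^ dac a c)
    (hδ : step k * C * μ * curvBound a C₁ C₂ G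
      + step k ^ 2 * (C ^ 2 + 2 * B) * envelopeConst a C₁ μ / (2 * μ)
        ≤ stepRate (dac a c) (step k) ν n / 4)
    (hnle : (A + 2 * B * ‖xs‖ ^ 2) / (2 * μ) ≤ n) :
    ∫ ω, envelope V a μ (x (k + 1) ω) ∂P
      ≤ (1 - 5 / 4 * stepRate (dac a c) (step k) ν n) * ∫ ω, envelope V a μ (x k ω) ∂P
        + dac a c * step k ^ 2 * n := by
  have hD := dac_pos ha hc
  have hS := slopeBound_pos ha hC₁ hC₂ hG
  set D := dac a c
  set α := step k with hαdef
  set φ := stepRate D α ν n with hφ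
  set M := envelope V a μ with hM
  set q := (C₁ / C₂) ^ (2 / a) / (1 + μ * slopeBound a C₁ C₂ G) ^ 2 with hq
  have hq0 : 0 < q := by positivity
  have hMc : Continuous M := continuous_moreauEnvelope (h.continuous_rpow ha) (h.rpow_nonneg hC₁) hμ
  set e := α * C * μ * curvBound a C₁ C₂ G + α ^ 2 * C ^ 2 * envelopeConst a C₁ μ / (2 * μ) with he
  -- The coefficient `3/2 * φ` is three quarters of the rate `2φ` from `contraction_le_rpow`, the
  -- quarter lost being allowed by `hνle`; `e` collects the linear errors of the drift.
  have h1 := hT.integral_envelope_le h ha hC hC₁ hμ hxs hr k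
    (U := fun z => (1 - 3 / 2 * φ + e) * M z + 3 / 4 * ((D - 1) * α ^ 2 * n)) (by fun_prop) (by
      intro z hz
      have h2 := h.envelope_drift_le ha hc hγ hC hC₁ hC₂ hG hμ hxs hα hr hsmall hz
      have hM0 := h.envelope_nonneg (a := a) hC₁ hμ z
      have h3 := contraction_le_rpow hD hα hν hn hM0
      rw [Real.mul_rpow hq0.le hM0] at h2
      have h4 : 3 / 4 * (α * ν * envelope V a μ z ^ D)
          ≤ α * (2 * γ / a) * (q ^ D * envelope V a μ z ^ D) := by
        have := mul_le_mul_of_nonneg_right hνle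
          (mul_nonneg hα.le (Real.rpow_nonneg hM0 D))
        linarith
      have e1 : D * α ^ (2 - 1 / D) * ν ^ (1 / D) * n ^ (1 - 1 / D) = 2 * φ := by
        rw [hφ, stepRate]
        ring
      rw [e1] at h3
      refine h2.trans ?_
      simp only [← hM] at h3 h4 ⊢
      linarith)
  have hMi : Integrable (fun ω => M (x k ω)) P := hT.integrable_envelope h ha hC₁ hμ k
  have hI0 : 0 ≤ ∫ ω, M (x k ω) ∂P := integral_nonneg fun ω => h.envelope_nonneg hC₁ hμ _
  have h5 : ∫ ω, ((1 - 3 / 2 * φ + e) * M (x k ω) + 3 / 4 * ((D - 1) * α ^ 2 * n)) ∂P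
      = (1 - 3 / 2 * φ + e) * ∫ ω, M (x k ω) ∂P + 3 / 4 * ((D - 1) * α ^ 2 * n) := by
    rw [integral_add (hMi.const_mul _) (integrable_const _), integral_const_mul]
    simp
  -- Splitting `‖x‖²` around `xs` yields the constant `A + 2B‖xs‖²` and one more error linear in the
  -- envelope.
  have h6 : ∫ ω, ‖x k ω‖ ^ 2 ∂P
      ≤ 2 * ‖xs‖ ^ 2 + 2 * (envelopeConst a C₁ μ * ∫ ω, M (x k ω) ∂P) := by
    have hb : ∀ ω, ‖x k ω‖ ^ 2 ≤ 2 * ‖xs‖ ^ 2 + 2 * ‖x k ω - xs‖ ^ 2 := by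
      intro ω
      have h7 : ‖x k ω‖ ≤ ‖xs‖ + ‖x k ω - xs‖ := by
        simpa using norm_add_le xs (x k ω - xs)
      have h8 : ‖x k ω‖ ^ 2 ≤ (‖xs‖ + ‖x k ω - xs‖) ^ 2 := by gcongr
      nlinarith [sq_nonneg (‖xs‖ - ‖x k ω - xs‖)]
    have h9 := integral_mono
      (integrable_comp_of_norm_le (g := fun z => ‖z‖ ^ 2) (by fun_prop)
        (hT.measurable_x k).aestronglyMeasurable (hT.bounded k))
      ((integrable_const (2 * ‖xs‖ ^ 2)).add ((hT.integrable_sq_norm_sub xs k).const_mul 2)) hb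
    have h10 : mse P x xs k ≤ envelopeConst a C₁ μ * ∫ ω, M (x k ω) ∂P :=
      hT.mse_le h ha hC₁ hμ k
    refine h9.trans ?_
    simp only [Pi.add_apply]
    rw [integral_add (integrable_const _) ((hT.integrable_sq_norm_sub xs k).const_mul 2),
      integral_const_mul 2 fun ω => ‖x k ω - xs‖ ^ 2]
    simp only [integral_const, probReal_univ, smul_eq_mul, one_mul]
    simp only [mse] at h10
    linarith
  rw [h5] at h1
  refine h1.trans ?_
  set I := ∫ ω, M (x k ω) ∂P
  have h11 : α ^ 2 / (2 * μ) * (A + B * ∫ ω, ‖x k ω‖ ^ 2 ∂P)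
      ≤ α ^ 2 * ((A + 2 * B * ‖xs‖ ^ 2) / (2 * μ))
        + α ^ 2 * (2 * B) * envelopeConst a C₁ μ / (2 * μ) * I := by
    have := mul_le_mul_of_nonneg_left (add_le_add_right (mul_le_mul_of_nonneg_left h6 hB) A)
      (by positivity : 0 ≤ α ^ 2 / (2 * μ))
    refine this.trans (le_of_eq ?_)
    ring
  have h12 : α ^ 2 * ((A + 2 * B * ‖xs‖ ^ 2) / (2 * μ)) ≤ α ^ 2 * n := by gcongr
  have h13 : e + α ^ 2 * (2 * B) * envelopeConst a C₁ μ / (2 * μ) ≤ φ / 4 := by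
    refine le_trans (le_of_eq ?_) hδ
    rw [he]
    ring
  have h14 := mul_le_mul_of_nonneg_right h13 hI0
  have h15 : 0 ≤ (D - 1) * α ^ 2 * n :=
    mul_nonneg (mul_nonneg (by linarith) (sq_nonneg _)) hn.le
  linarith


end Contraction

/-! ### Supersolutions of scalar recursions -/

section Recursions

variable {n s φ ω d K p : ℝ} {u : ℕ → ℝ}

theorem inv_add_one_le_log_add_one_sub_log (hn : 0 < n) :
    1 / (n + 1) ≤ Real.log (n + 1) - Real.log n := by
  have h := Real.log_le_sub_one_of_pos (show 0 < n / (n + 1) by positivity)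
  rw [Real.log_div hn.ne' (by positivity)] at h
  have : n / (n + 1) - 1 = -(1 / (n + 1)) := by
    field_simp
    ring
  linarith

theorem log_add_one_sub_log_le_inv (hn : 0 < n) : Real.log (n + 1) - Real.log n ≤ 1 / n := by
  have h := Real.log_le_sub_one_of_pos (show 0 < (n + 1) / n by positivity)
  rw [Real.log_div (by positivity) hn.ne'] at h
  have : (n + 1) / n - 1 = 1 / n := by
    field_simp
    ring
  linarith

theorem rpow_neg_mul_le (hn : 0 < n) (hs : 0 ≤ s) :
    (1 - s / n) * n ^ (-s) ≤ (n + 1) ^ (-s) := by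
  rw [Real.rpow_def_of_pos hn, Real.rpow_def_of_pos (by positivity : 0 < n + 1)]
  have h1 := log_add_one_sub_log_le_inv hn
  have h2 := Real.add_one_le_exp (-s / n)
  have h3 : Real.exp (-s / n) * Real.exp (Real.log n * -s) ≤ Real.exp (Real.log (n + 1) * -s) := by
    rw [← Real.exp_add, Real.exp_le_exp]
    have := mul_le_mul_of_nonneg_left h1 hs
    have e : s * (1 / n) = -(-s / n) := by ring
    linarith
  refine le_trans (mul_le_mul_of_nonneg_right ?_ (Real.exp_pos _).le) h3
  rw [neg_div] at h2 ⊢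
  linarith

theorem le_of_constant_recursion (hφ : 0 < φ) (hφ1 : φ ≤ 1) (hω : 0 ≤ ω)
    (hu : ∀ k, u (k + 1) ≤ (1 - φ) * u k + ω) (k : ℕ) :
    u k ≤ u 0 * (1 - φ) ^ k + ω / φ := by
  induction k with
  | zero =>
    have : 0 ≤ ω / φ := by positivity
    simpa using this
  | succ k ih =>
    have h1 := mul_le_mul_of_nonneg_left ih (by linarith : 0 ≤ 1 - φ)
    have h2 : (1 - φ) * (u 0 * (1 - φ) ^ k + ω / φ) + ω = u 0 * (1 - φ) ^ (k + 1) + ω / φ := by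
      rw [pow_succ]
      field_simp
      ring
    linarith [hu k]

/-- The exponential dominates the homogeneous part, by concavity of `n ↦ n^p`. The second term is
twice the instantaneous equilibrium `ω/(φ n^s)`: the spare half pays for the decay from `n^{-s}` to
`(n+1)^{-s}`, which is what `hsK` ensures. -/
theorem le_of_subharmonic_recursion (hK : 0 < K) (hp : 0 < p) (hp1 : p ≤ 1) (hs : 0 ≤ s)
    (hφ : 0 < φ) (hω : 0 ≤ ω) (hu0 : 0 ≤ u 0) (hφK : ∀ k : ℕ, φ / (k + K) ^ (1 - p) ≤ 1)
    (hsK : ∀ k : ℕ, 2 * s ≤ φ * (k + K) ^ p)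
    (hu : ∀ k : ℕ, u (k + 1) ≤ (1 - φ / (k + K) ^ (1 - p)) * u k + ω / (k + K) ^ (1 - p + s))
    (k : ℕ) :
    u k ≤ u 0 * Real.exp (-(φ * ((k + K) ^ p - K ^ p) / p)) + 2 * ω / (φ * (k + K) ^ s) := by
  induction k with
  | zero =>
    have : 0 ≤ 2 * ω / (φ * K ^ s) := by positivity
    simpa using this
  | succ k ih =>
    have hn : 0 < (k : ℝ) + K := by positivity
    have hcast : ((k + 1 : ℕ) : ℝ) + K = (k + K) + 1 := by push_cast; ring
    rw [hcast]
    have h1 := hφK k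
    have h2 := hsK k
    refine (hu k).trans ?_
    generalize (k : ℝ) + K = n at *
    refine (add_le_add_left (mul_le_mul_of_nonneg_left ih (by linarith)) _).trans ?_
    rw [mul_add, add_assoc]
    refine add_le_add ?_ ?_
    · rw [mul_left_comm]
      refine mul_le_mul_of_nonneg_left ?_ hu0
      have h3 := Real.add_one_le_exp (-(φ / n ^ (1 - p)))
      have h4 : (n + 1) ^ p - n ^ p ≤ p / n ^ (1 - p) := by
        have h5 := rpow_one_add_le_one_add_mul_self (s := 1 / n)
          (by linarith [one_div_pos.2 hn]) hp.le hp1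
        have h6 : n + 1 = n * (1 + 1 / n) := by field_simp
        rw [h6, Real.mul_rpow hn.le (by positivity)]
        have h7 := mul_le_mul_of_nonneg_left h5 (Real.rpow_nonneg hn.le p)
        have h8 : n ^ p * (1 + p * (1 / n)) = n ^ p + p / n ^ (1 - p) := by
          rw [Real.rpow_sub hn, Real.rpow_one]
          field_simp
        linarith
      calc (1 - φ / n ^ (1 - p)) * Real.exp (-(φ * (n ^ p - K ^ p) / p))
          ≤ Real.exp (-(φ / n ^ (1 - p))) * Real.exp (-(φ * (n ^ p - K ^ p) / p)) := by
            gcongr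
            linarith
        _ = Real.exp (-(φ / n ^ (1 - p)) + -(φ * (n ^ p - K ^ p) / p)) := (Real.exp_add _ _).symm
        _ ≤ Real.exp (-(φ * ((n + 1) ^ p - K ^ p) / p)) := by
            rw [Real.exp_le_exp]
            have h5 := mul_le_mul_of_nonneg_left h4 (by positivity : 0 ≤ φ / p)
            have e1 : φ / p * (p / n ^ (1 - p)) = φ / n ^ (1 - p) := by field_simp
            have e2 : φ * ((n + 1) ^ p - K ^ p) / p
                = φ / p * ((n + 1) ^ p - n ^ p) + φ * (n ^ p - K ^ p) / p := by ring
            linarith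
    · have h3 := mul_le_mul_of_nonneg_left (rpow_neg_mul_le hn hs)
        (by positivity : 0 ≤ 2 * ω / φ)
      have e1 : 2 * ω / (φ * (n + 1) ^ s) = 2 * ω / φ * (n + 1) ^ (-s) := by
        rw [Real.rpow_neg (by positivity)]
        field_simp
      rw [e1]
      refine le_trans ?_ h3
      have hns : 0 < n ^ s := by positivity
      have hnp : 0 < n ^ p := by positivity
      have e2 : (1 - φ / n ^ (1 - p)) * (2 * ω / (φ * n ^ s)) + ω / n ^ (1 - p + s)
          = 2 * ω / φ * n ^ (-s) - ω * n ^ p / (n * n ^ s) := by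
        rw [Real.rpow_add hn, Real.rpow_sub hn, Real.rpow_one, Real.rpow_neg hn.le]
        field_simp
        ring
      have e3 : 2 * ω / φ * ((1 - s / n) * n ^ (-s))
          = 2 * ω / φ * n ^ (-s) - ω * (2 * s / φ) / (n * n ^ s) := by
        rw [Real.rpow_neg hn.le]
        field_simp
      rw [e2, e3]
      have h4 : 2 * s / φ ≤ n ^ p := by
        rw [div_le_iff₀ hφ]
        linarith
      have h5 : ω * (2 * s / φ) / (n * n ^ s) ≤ ω * n ^ p / (n * n ^ s) := by gcongr
      linarith

/-- Since `(1 - φ/n) n^{-φ} ≤ (n+1)^{-φ}`, the weighted quantity `n^φ u` grows only through the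
noise, by at most `2^d ω (n+1)^{φ-d}` per step; the factor `2^d` comes from `n + 1 ≤ 2n`. Any `Q`
majorizing the partial sums gives a bound, and the three regimes are three choices of `Q`. -/
theorem le_of_harmonic_recursion (hK : 1 ≤ K) (hφ : 0 < φ) (hφK : φ ≤ K) (hω : 0 ≤ ω)
    (hd : 0 ≤ d) (hu0 : 0 ≤ u 0)
    (hu : ∀ k : ℕ, u (k + 1) ≤ (1 - φ / (k + K)) * u k + ω / (k + K) ^ d)
    {Q : ℕ → ℝ} (hQ0 : 0 ≤ Q 0) (hQ : ∀ k : ℕ, Q k + ((k : ℝ) + K + 1) ^ (φ - d) ≤ Q (k + 1))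
    (k : ℕ) :
    u k ≤ u 0 * (K / (k + K)) ^ φ + 1 / (k + K) ^ φ * (2 ^ d * ω * Q k) := by
  have hK0 : 0 < K := by linarith
  have hQn : ∀ k, 0 ≤ Q k := by
    intro k
    induction k with
    | zero => exact hQ0
    | succ k ih =>
      have : 0 ≤ ((k : ℝ) + K + 1) ^ (φ - d) := by positivity
      linarith [hQ k]
  have hform : ∀ n : ℝ, 0 < n → ∀ q : ℝ, u 0 * (K / n) ^ φ + 1 / n ^ φ * (2 ^ d * ω * q)
      = n ^ (-φ) * (u 0 * K ^ φ + 2 ^ d * ω * q) := by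
    intro n hn q
    rw [Real.div_rpow hK0.le hn.le, Real.rpow_neg hn.le]
    ring
  induction k with
  | zero =>
    have : 0 ≤ 1 / K ^ φ * (2 ^ d * ω * Q 0) := by positivity
    simp only [Nat.cast_zero, zero_add, div_self hK0.ne', Real.one_rpow]
    linarith
  | succ k ih =>
    have hn : K ≤ (k : ℝ) + K := by linarith [(Nat.cast_nonneg k : (0 : ℝ) ≤ k)]
    have hcast : ((k + 1 : ℕ) : ℝ) + K = (k + K) + 1 := by push_cast; ring
    rw [hcast]
    have hQk := hQ k
    have hQk0 := hQn k
    refine (hu k).trans ?_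
    generalize (k : ℝ) + K = n at *
    have hn0 : 0 < n := by linarith
    rw [hform _ hn0] at ih
    rw [hform _ (by linarith)]
    have h1 : φ / n ≤ 1 := (div_le_one hn0).2 (by linarith)
    have h2 := rpow_neg_mul_le hn0 hφ.le
    have h3 := mul_le_mul_of_nonneg_left ih (by linarith : 0 ≤ 1 - φ / n)
    have h4 : 0 ≤ u 0 * K ^ φ + 2 ^ d * ω * Q k := by positivity
    have h5 := mul_le_mul_of_nonneg_right h2 h4
    have h6 : ω / n ^ d ≤ (n + 1) ^ (-φ) * (2 ^ d * ω * (n + 1) ^ (φ - d)) := by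
      have e : (n + 1) ^ (-φ) * (2 ^ d * ω * (n + 1) ^ (φ - d)) = ω * (2 ^ d / (n + 1) ^ d) := by
        have : (n + 1) ^ (-φ) * (n + 1) ^ (φ - d) = 1 / (n + 1) ^ d := by
          rw [← Real.rpow_add (by positivity), neg_add_eq_sub, sub_sub_cancel_left,
            Real.rpow_neg (by positivity), one_div]
        calc _ = 2 ^ d * ω * ((n + 1) ^ (-φ) * (n + 1) ^ (φ - d)) := by ring
          _ = _ := by rw [this]; ring
      rw [e, div_eq_mul_one_div]
      refine mul_le_mul_of_nonneg_left ?_ hω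
      rw [div_le_div_iff₀ (by positivity) (by positivity), one_mul,
        ← Real.mul_rpow (by norm_num) hn0.le]
      exact Real.rpow_le_rpow (by positivity) (by linarith) hd
    have h7 : (n + 1) ^ (-φ) * (2 ^ d * ω * (Q k + (n + 1) ^ (φ - d)))
        ≤ (n + 1) ^ (-φ) * (2 ^ d * ω * Q (k + 1)) := by gcongr
    linarith

/-- The harmonic recursion with a slow contraction rate: the rate determines the decay. -/
theorem le_of_harmonic_recursion_of_lt (hK : 1 ≤ K) (hφ : 0 < φ) (hφK : φ ≤ K) (hω : 0 ≤ ω)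
    (hd : 0 ≤ d) (hu0 : 0 ≤ u 0)
    (hu : ∀ k : ℕ, u (k + 1) ≤ (1 - φ / (k + K)) * u k + ω / (k + K) ^ d)
    (hlt : φ < d - 1) (k : ℕ) :
    u k ≤ u 0 * (K / (k + K)) ^ φ + 1 / (k + K) ^ φ * (2 ^ d * ω / (d - 1 - φ)) := by
  have hK0 : 0 < K := by linarith
  have hp : 0 < d - 1 - φ := by linarith
  set p := d - 1 - φ with hpdef
  have h := le_of_harmonic_recursion hK hφ hφK hω hd hu0 hu
    (Q := fun k => (K ^ (-p) - ((k : ℝ) + K) ^ (-p)) / p) (by simp) (by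
      intro k
      have hn : 0 < (k : ℝ) + K := by positivity
      have hcast : ((k + 1 : ℕ) : ℝ) + K = (k + K) + 1 := by push_cast; ring
      rw [hcast, show φ - d = -p - 1 by rw [hpdef]; ring]
      generalize (k : ℝ) + K = n at *
      have hn1 : 0 < n + 1 := by positivity
      have h1 := inv_add_one_le_log_add_one_sub_log hn
      have h2 := Real.add_one_le_exp (p / (n + 1))
      have h3 : Real.exp (p / (n + 1)) * (n + 1) ^ (-p) ≤ n ^ (-p) := by
        rw [Real.rpow_def_of_pos hn, Real.rpow_def_of_pos hn1, ← Real.exp_add, Real.exp_le_exp]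
        have := mul_le_mul_of_nonneg_left h1 hp.le
        have e : p * (1 / (n + 1)) = p / (n + 1) := by ring
        linarith
      have h4 := mul_le_mul_of_nonneg_right h2 (Real.rpow_nonneg hn1.le (-p))
      have e : (n + 1) ^ (-p - 1) = p / (n + 1) * (n + 1) ^ (-p) / p := by
        rw [Real.rpow_sub hn1, Real.rpow_one]
        field_simp
      rw [e, ← add_div]
      gcongr
      linarith) k
  refine h.trans ?_
  have hn : 0 < (k : ℝ) + K := by positivity
  have h1 : K ^ (-p) ≤ 1 := Real.rpow_le_one_of_one_le_of_nonpos hK (by linarith)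
  have h2 : 0 ≤ ((k : ℝ) + K) ^ (-p) := by positivity
  have h3 : 2 ^ d * ω * ((K ^ (-p) - ((k : ℝ) + K) ^ (-p)) / p) ≤ 2 ^ d * ω / p := by
    rw [← mul_div_assoc]
    refine div_le_div_of_nonneg_right ?_ hp.le
    exact mul_le_of_le_one_right (by positivity) (by linarith)
  gcongr

/-- Here the noise increments sum like `1/n`, so `Q` is the logarithm. -/
theorem le_of_harmonic_recursion_of_eq (hK : 1 ≤ K) (hφ : 0 < φ) (hφK : φ ≤ K) (hω : 0 ≤ ω)
    (hd : 0 ≤ d) (hu0 : 0 ≤ u 0)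
    (hu : ∀ k : ℕ, u (k + 1) ≤ (1 - φ / (k + K)) * u k + ω / (k + K) ^ d)
    (heq : φ = d - 1) (k : ℕ) :
    u k ≤ u 0 * (K / (k + K)) ^ φ + Real.log (k + K) / (k + K) ^ (d - 1) * (2 ^ d * ω) := by
  have hK0 : 0 < K := by linarith
  have h := le_of_harmonic_recursion hK hφ hφK hω hd hu0 hu
    (Q := fun k => Real.log ((k : ℝ) + K)) (by simpa using Real.log_nonneg hK) (by
      intro k
      have hn : 0 < (k : ℝ) + K := by positivity
      have hcast : ((k + 1 : ℕ) : ℝ) + K = (k + K) + 1 := by push_cast; ring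
      rw [hcast, show φ - d = -1 by rw [heq]; ring, Real.rpow_neg_one]
      have := inv_add_one_le_log_add_one_sub_log hn
      rw [one_div] at this
      linarith) k
  refine h.trans (le_of_eq ?_)
  rw [heq]
  ring

theorem le_of_harmonic_recursion_of_gt (hK : 1 ≤ K) (hφ : 0 < φ) (hφK : φ ≤ K) (hω : 0 ≤ ω)
    (hd : 1 ≤ d) (hu0 : 0 ≤ u 0)
    (hu : ∀ k : ℕ, u (k + 1) ≤ (1 - φ / (k + K)) * u k + ω / (k + K) ^ d)
    (hgt : d - 1 < φ) (k : ℕ) :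
    u k ≤ u 0 * (K / (k + K)) ^ φ
      + 1 / (k + K) ^ (d - 1) * (Real.exp 1 * 2 ^ d * ω / (φ - (d - 1))) := by
  have hK0 : 0 < K := by linarith
  have hq : 0 < φ - (d - 1) := by linarith
  set q := φ - (d - 1) with hqdef
  have h := le_of_harmonic_recursion hK hφ hφK hω (by linarith) hu0 hu
    (Q := fun k => Real.exp 1 * ((k : ℝ) + K) ^ q / q) (by positivity) (by
      intro k
      have hnK : K ≤ (k : ℝ) + K := by linarith [(Nat.cast_nonneg k : (0 : ℝ) ≤ k)]
      have hcast : ((k + 1 : ℕ) : ℝ) + K = (k + K) + 1 := by push_cast; ring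
      rw [hcast, show φ - d = q - 1 by rw [hqdef]; ring]
      generalize (k : ℝ) + K = n at *
      have hn : 0 < n := by linarith
      have hn1 : 0 < n + 1 := by positivity
      have h1 := inv_add_one_le_log_add_one_sub_log hn
      have h2 := log_add_one_sub_log_le_inv hn
      have h3 : (1 + q / (n + 1)) * n ^ q ≤ (n + 1) ^ q := by
        have h4 := Real.add_one_le_exp (q / (n + 1))
        have h5 : Real.exp (q / (n + 1)) * n ^ q ≤ (n + 1) ^ q := by
          rw [Real.rpow_def_of_pos hn, Real.rpow_def_of_pos hn1, ← Real.exp_add, Real.exp_le_exp]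
          have := mul_le_mul_of_nonneg_left h1 hq.le
          have e : q * (1 / (n + 1)) = q / (n + 1) := by ring
          linarith
        refine le_trans (mul_le_mul_of_nonneg_right ?_ (Real.rpow_nonneg hn.le q)) h5
        linarith
      -- The factor `e` in the bound: it costs this much to pass from `n + 1` to `n`, because `q ≤ φ
      -- ≤ K ≤ n`. It allows one formula for `q < 1` and `q > 1`.
      have h6 : (n + 1) ^ q ≤ Real.exp 1 * n ^ q := by
        rw [Real.rpow_def_of_pos hn, Real.rpow_def_of_pos hn1, ← Real.exp_add, Real.exp_le_exp]
        have := mul_le_mul_of_nonneg_left h2 hq.le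
        have e : q * (1 / n) ≤ 1 := by
          rw [mul_one_div, div_le_one hn]
          linarith
        linarith
      have h7 : (n + 1) ^ (q - 1) ≤ Real.exp 1 * (q / (n + 1) * n ^ q) / q := by
        rw [Real.rpow_sub hn1, Real.rpow_one]
        have e : Real.exp 1 * (q / (n + 1) * n ^ q) / q = Real.exp 1 * n ^ q / (n + 1) := by
          field_simp
        rw [e]
        gcongr
      have h8 : Real.exp 1 * ((1 + q / (n + 1)) * n ^ q) / q ≤ Real.exp 1 * (n + 1) ^ q / q := by
        gcongr
      have e : Real.exp 1 * ((1 + q / (n + 1)) * n ^ q) / q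
          = Real.exp 1 * n ^ q / q + Real.exp 1 * (q / (n + 1) * n ^ q) / q := by ring
      linarith) k
  refine h.trans (le_of_eq ?_)
  have hn : 0 < (k : ℝ) + K := by positivity
  have e : ((k : ℝ) + K) ^ φ = ((k : ℝ) + K) ^ q * ((k : ℝ) + K) ^ (d - 1) := by
    rw [← Real.rpow_add hn, hqdef, sub_add_cancel]
  have h1 : 0 < ((k : ℝ) + K) ^ q := by positivity
  have h2 : 0 < ((k : ℝ) + K) ^ (d - 1) := by positivity
  rw [e]
  field_simp

end Recursions


/-! ### Positivity, monotonicity and scaling of the constants -/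

section Constants

variable {a c γ C C₁ C₂ G A B s α μ μ₀ : ℝ}

theorem phi_eq_stepRate : phi a c γ C C₁ C₂ G A B s α μ μ₀
    = stepRate (dac a c) α (nu4 a c γ C₁ C₂ G μ₀) (noiseLevel a C C₂ G A B s μ μ₀) := rfl

theorem gM_pos (ha : 0 < a) (hC₂ : 0 < C₂) (hG : 0 < G) : 0 < gM a G C₂ := by
  unfold gM
  positivity

theorem nC_pos (hAB : 0 < A + 2 * B * s ^ 2) : 0 < nC C A B s := by
  unfold nC
  positivity

theorem nu4_pos (ha : 0 < a) (hγ : 0 < γ) (hC₁ : 0 < C₁) (hC₂ : 0 < C₂) (hG : 0 < G)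
    (hμ₀ : 0 ≤ μ₀) : 0 < nu4 a c γ C₁ C₂ G μ₀ := by
  have := gM_pos ha hC₂ hG
  unfold nu4
  positivity

theorem nu4_anti (ha : 0 < a) (hγ : 0 < γ) (hC₁ : 0 < C₁) (hC₂ : 0 < C₂) (hG : 0 < G)
    (hμ₀ : 0 ≤ μ₀) (hle : μ₀ ≤ μ) : nu4 a c γ C₁ C₂ G μ ≤ nu4 a c γ C₁ C₂ G μ₀ := by
  have := gM_pos ha hC₂ hG
  unfold nu4
  gcongr

theorem noiseLevel_pos (hAB : 0 < A + 2 * B * s ^ 2) (hμ : 0 < μ) :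
    0 < noiseLevel a C C₂ G A B s μ μ₀ := by
  have := nC_pos (C := C) hAB
  unfold noiseLevel
  positivity

theorem noiseLevel_mono (hAB : 0 < A + 2 * B * s ^ 2) (hμ : 0 < μ) (hμ₀ : 0 ≤ μ₀) {μ₁ : ℝ}
    (hle : μ₀ ≤ μ₁) : noiseLevel a C C₂ G A B s μ μ₀ ≤ noiseLevel a C C₂ G A B s μ μ₁ := by
  have := nC_pos (C := C) hAB
  unfold noiseLevel
  gcongr

theorem omega_pos (ha : 0 < a) (hc : 1 ≤ c) (hAB : 0 < A + 2 * B * s ^ 2) (hα : 0 < α)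
    (hμ : 0 < μ) : 0 < omega a c C C₂ G A B s α μ μ₀ := by
  have := dac_pos ha hc
  have := noiseLevel_pos (a := a) (C := C) (C₂ := C₂) (G := G) (μ₀ := μ₀) hAB hμ
  unfold omega
  positivity

theorem stepRate_pos {D ν n : ℝ} (hD : 1 ≤ D) (hα : 0 < α) (hν : 0 < ν) (hn : 0 < n) :
    0 < stepRate D α ν n := by
  unfold stepRate
  positivity

theorem stepRate_mono {D ν ν' n n' : ℝ} (hD : 1 ≤ D) (hα : 0 < α) (hν : 0 < ν) (hn : 0 < n)
    (hνν : ν ≤ ν') (hnn : n ≤ n') : stepRate D α ν n ≤ stepRate D α ν' n' := by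
  have h1 : 1 / D ≤ 1 := by
    rw [div_le_one (by linarith)]
    exact hD
  have h2 : 0 ≤ 1 - 1 / D := by linarith
  have h3 : 0 < ν' := hν.trans_le hνν
  unfold stepRate
  gcongr

theorem phi_pos (ha : 0 < a) (hc : 1 ≤ c) (hγ : 0 < γ) (hC₁ : 0 < C₁) (hC₂ : 0 < C₂) (hG : 0 < G)
    (hAB : 0 < A + 2 * B * s ^ 2) (hα : 0 < α) (hμ : 0 < μ) (hμ₀ : 0 ≤ μ₀) :
    0 < phi a c γ C C₁ C₂ G A B s α μ μ₀ :=
  stepRate_pos (dac_pos ha hc) hα (nu4_pos ha hγ hC₁ hC₂ hG hμ₀) (noiseLevel_pos hAB hμ)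

/-- Steps scale as `t^{-ξ}` and the noise level as `1/μ_k`, hence as `t^{ξ/2}`; the resulting power
of `t` is the exponent `ξ'`. -/
theorem stepRate_scale {D ν n t ξ : ℝ} (hD : 1 ≤ D) (hα : 0 < α) (hn : 0 < n) (ht : 0 < t) :
    stepRate D (α / t ^ ξ) ν (n * t ^ (ξ / 2))
      = stepRate D α ν n / t ^ ((3 * D - 1) * ξ / (2 * D)) := by
  have hD0 : D ≠ 0 := by linarith
  unfold stepRate
  rw [Real.div_rpow hα.le (by positivity), Real.mul_rpow hn.le (by positivity),
    ← Real.rpow_mul ht.le, ← Real.rpow_mul ht.le,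
    show ξ * (2 - 1 / D) = (3 * D - 1) * ξ / (2 * D) + ξ / 2 * (1 - 1 / D) by
      field_simp
      ring, Real.rpow_add ht]
  have h1 : 0 < t ^ (ξ / 2 * (1 - 1 / D)) := by positivity
  have h2 : 0 < t ^ ((3 * D - 1) * ξ / (2 * D)) := by positivity
  field_simp

/-- The proved decrease carries `(1 + μ S)^{2D}`, with `S` the slope bound, in place of the factor
`(1 + μ₀ G_M)²` in `ν₄`. Comparing with `ν₄` at `μ₀ = 0` avoids relating the two; small `μ` then
loses at most a quarter. -/
theorem three_fourths_mul_nu4_le (ha : 0 < a) (hγ : 0 < γ) (hC₁ : 0 < C₁) (hC₂ : 0 < C₂)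
    (hG : 0 < G) (hμ : 0 < μ) (hμ₀ : 0 ≤ μ₀)
    (h : ((1 + μ * slopeBound a C₁ C₂ G) ^ 2) ^ dac a c ≤ 4 / 3) :
    3 / 4 * nu4 a c γ C₁ C₂ G μ₀ ≤ 2 * γ / a
      * ((C₁ / C₂) ^ (2 / a) / (1 + μ * slopeBound a C₁ C₂ G) ^ 2) ^ dac a c := by
  have hS := slopeBound_pos ha hC₁ hC₂ hG
  have h1 := nu4_anti (c := c) ha hγ hC₁ hC₂ hG le_rfl hμ₀
  rw [Real.div_rpow (by positivity) (by positivity), ← Real.rpow_mul (by positivity),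
    show 2 / a * dac a c = c - 1 + 2 / a by
      unfold dac
      field_simp]
  have h2 : nu4 a c γ C₁ C₂ G 0 = 2 * γ / a * (C₁ / C₂) ^ (c - 1 + 2 / a) := by
    unfold nu4
    rw [zero_mul, add_zero, one_pow, mul_one]
    ring
  rw [h2] at h1
  have hpos : 0 < ((1 + μ * slopeBound a C₁ C₂ G) ^ 2) ^ dac a c := by positivity
  have h3 : 0 < 2 * γ / a * (C₁ / C₂) ^ (c - 1 + 2 / a) := by positivity
  rw [← mul_div_assoc, le_div_iff₀ hpos]
  have h4 : 3 / 4 * nu4 a c γ C₁ C₂ G μ₀ * ((1 + μ * slopeBound a C₁ C₂ G) ^ 2) ^ dac a c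
      ≤ 3 / 4 * (2 * γ / a * (C₁ / C₂) ^ (c - 1 + 2 / a)) * (4 / 3) := by
    gcongr
  linarith

/-- Keeps the factor `C² + 1` as slack: with diminishing steps it absorbs the passage from `μ_k` to
`μ_{k+1}`. -/
theorem mul_le_noiseLevel (hAB : 0 < A + 2 * B * s ^ 2) (hμ : 0 < μ) :
    (C ^ 2 + 1) * ((A + 2 * B * s ^ 2) / (2 * μ)) ≤ noiseLevel a C C₂ G A B s μ μ₀ := by
  unfold noiseLevel nC
  rw [← mul_div_assoc]
  refine div_le_div_of_nonneg_right (le_mul_of_one_le_left (by positivity) ?_) (by positivity)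
  linarith [mul_nonneg (sq_nonneg μ₀) (sq_nonneg (gM a G C₂))]

theorem envelopeConst_mono {μ' : ℝ} (h : μ' ≤ μ) :
    envelopeConst a C₁ μ' ≤ envelopeConst a C₁ μ := by
  unfold envelopeConst
  linarith

theorem curvBound_nonneg (hC₁ : 0 < C₁) : 0 ≤ curvBound a C₁ C₂ G := by
  unfold curvBound
  positivity

theorem contraction_mul_growth_le (ψ : ℝ) {I : ℝ} (hI : 0 ≤ I) :
    (1 - 5 / 4 * ψ) * ((1 + ψ / 4) * I) ≤ (1 - ψ) * I := by
  have : 0 ≤ ψ ^ 2 * I := by positivity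
  linarith

end Constants

/-! ### One step with diminishing step size and smoothing parameter -/

section DiminishingStep

variable {m : ℕ} {V : EuclideanSpace ℝ (Fin m) → ℝ}
    {F : EuclideanSpace ℝ (Fin m) → EuclideanSpace ℝ (Fin m)} {xs : EuclideanSpace ℝ (Fin m)}
    {a c γ C C₁ C₂ G ρ α μ : ℝ} {Ω : Type*} [mΩ : MeasurableSpace Ω] {P : Measure Ω}
    {A B r K ξ : ℝ} {x w : ℕ → Ω → EuclideanSpace ℝ (Fin m)}

set_option maxHeartbeats 800000 in
/-- With diminishing steps and smoothing parameters, the mean envelope satisfies a contractive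
recursion once the time `k + K` is large. -/
theorem IsTrajectory.integral_envelope_diminishing [IsProbabilityMeasure P]
    (hT : IsTrajectory P F (fun k => α / ((k : ℝ) + K) ^ ξ) A B r x w)
    (h : SystemAssumptions V F xs a c γ C C₁ C₂ G ρ)
    (ha : 0 < a) (hc : 1 ≤ c) (hγ : 0 < γ) (hC : 0 < C) (hC₁ : 0 < C₁) (hC₂ : 0 < C₂)
    (hG : 0 < G) (hB : 0 ≤ B) (hAB : 0 < A + 2 * B * ‖xs‖ ^ 2) (hxs : ‖xs‖ ≤ ρ) (hr : r < ρ)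
    (hα : 0 < α) (hμ : 0 < μ) {μ₀ : ℝ} (hμ₀ : 0 ≤ μ₀) (hξ : 0 < ξ) (hξ1 : ξ ≤ 1)
    (hξ' : (3 * dac a c - 1) * ξ / (2 * dac a c) ≤ 1) (k : ℕ) (hn : 1 ≤ (k : ℝ) + K)
    {φ : ℝ} (hφ : φ = phi a c γ C C₁ C₂ G A B ‖xs‖ α μ μ₀)
    (h1 : μ / (k + K) ^ (ξ / 2) * (slopeBound a C₁ C₂ G * (√((C₂ / C₁) ^ (2 / a)) * (2 * ρ)))
      ≤ ρ - r)
    (h2 : ((1 + μ / (k + K) ^ (ξ / 2) * slopeBound a C₁ C₂ G) ^ 2) ^ dac a c ≤ 4 / 3)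
    (h3 : 1 / ((k : ℝ) + K) ≤ C ^ 2)
    (h4 : (α * C * μ * curvBound a C₁ C₂ G
        + α ^ 2 * (C ^ 2 + 2 * B) * envelopeConst a C₁ μ * (C ^ 2 + 1) / (2 * μ))
          / (k + K) ^ (ξ / (2 * dac a c)) ≤ φ / 4)
    (h5 : curvBound a C₁ C₂ G / 2 * μ / (k + K) ^ (ξ / 2) ≤ φ / 4)
    (h6 : φ / (k + K) ^ ((3 * dac a c - 1) * ξ / (2 * dac a c)) ≤ 4 / 5) :
    ∫ ω, envelope V a (μ / (((k + 1 : ℕ) : ℝ) + K) ^ (ξ / 2)) (x (k + 1) ω) ∂P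
      ≤ (1 - φ / (k + K) ^ ((3 * dac a c - 1) * ξ / (2 * dac a c)))
          * ∫ ω, envelope V a (μ / (k + K) ^ (ξ / 2)) (x k ω) ∂P
        + omega a c C C₂ G A B ‖xs‖ α μ μ₀ / (k + K) ^ (3 * ξ / 2) := by
  have hD := dac_pos ha hc
  have hL := curvBound_nonneg (a := a) (C₂ := C₂) (G := G) hC₁
  have hS := slopeBound_pos ha hC₁ hC₂ hG
  have hρ : 0 ≤ ρ := (norm_nonneg xs).trans hxs
  rw [show ((k + 1 : ℕ) : ℝ) + K = (k + K) + 1 by push_cast; ring]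
  -- The whole step is analysed with the next parameter `μ_{k+1}`; the change of parameter is then
  -- made at time `k`, before the contraction acts.
  have hcontr := hT.integral_envelope_contraction h ha hc hγ hC hC₁ hC₂ hG hB (k := k)
    (μ := μ / ((k : ℝ) + K + 1) ^ (ξ / 2)) (n := noiseLevel a C C₂ G A B ‖xs‖ μ μ₀ * (k + K) ^ (ξ / 2))
    (ν := nu4 a c γ C₁ C₂ G μ₀)
  have hchange := hT.integral_envelope_le_of_le h ha hC₁ hC₂ hG (k := k)
    (μ' := μ / ((k : ℝ) + K + 1) ^ (ξ / 2)) (μ := μ / ((k : ℝ) + K) ^ (ξ / 2))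
  have hI0 : 0 ≤ ∫ ω, envelope V a (μ / ((k : ℝ) + K) ^ (ξ / 2)) (x k ω) ∂P :=
    integral_nonneg fun ω => h.envelope_nonneg hC₁ (by positivity) _
  generalize (k : ℝ) + K = n at *
  set D := dac a c with hDdef
  have hn0 : 0 < n := by linarith
  set N := noiseLevel a C C₂ G A B ‖xs‖ μ μ₀ with hNdef
  have hN : 0 < N := noiseLevel_pos hAB hμ
  have hν := nu4_pos (c := c) ha hγ hC₁ hC₂ hG hμ₀
  set R := n ^ (ξ / 2) with hR
  set R' := (n + 1) ^ (ξ / 2) with hR'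
  set τ := n ^ ((3 * D - 1) * ξ / (2 * D)) with hτ
  have hR0 : 0 < R := by positivity
  have hR'0 : 0 < R' := by positivity
  have hτ0 : 0 < τ := by positivity
  have hR1 : 1 ≤ R := Real.one_le_rpow hn (by positivity)
  have hRR' : R ≤ R' := Real.rpow_le_rpow hn0.le (by linarith) (by positivity)
  have hR'n : R' ≤ R * (1 + 1 / n) := by
    have e : n + 1 = n * (1 + 1 / n) := by field_simp
    rw [hR', e, Real.mul_rpow hn0.le (by positivity)]
    refine mul_le_mul_of_nonneg_left ?_ hR0.le
    refine Real.rpow_le_self_of_one_le ?_ (by linarith)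
    linarith [one_div_pos.2 hn0]
  -- The noise is divided by `μ_{k+1}` rather than `μ_k`; once `1/n ≤ C²` the ratio fits into the
  -- factor `C² + 1` of `N_C`.
  have hR'C : R' ≤ R * (C ^ 2 + 1) :=
    hR'n.trans (mul_le_mul_of_nonneg_left (by linarith) hR0.le)
  have hμ'pos : 0 < μ / R' := by positivity
  have hμ'le : μ / R' ≤ μ / R := by gcongr
  have hμ'μ : μ / R' ≤ μ := div_le_self hμ.le (hR1.trans hRR')
  have hφ0 : 0 < φ := hφ ▸ phi_pos ha hc hγ hC₁ hC₂ hG hAB hα hμ hμ₀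
  have hrate : stepRate D (α / n ^ ξ) (nu4 a c γ C₁ C₂ G μ₀) (N * R) = φ / τ := by
    rw [hR, stepRate_scale hD hα hN hn0, hφ, phi_eq_stepRate]
  have hξR : n ^ ξ = R * R := by
    rw [hR, ← Real.rpow_add hn0]
    congr 1
    ring
  have hR3 : n ^ (3 * ξ / 2) = R * R * R := by
    rw [← hξR, hR, ← Real.rpow_add hn0]
    congr 1
    ring
  have hτR : τ * n ^ (ξ / (2 * D)) = R * R * R := by
    rw [← hR3, hτ, ← Real.rpow_add hn0]
    congr 1
    field_simp
    ring
  have hτn : τ ≤ n := by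
    have := Real.rpow_le_rpow_of_exponent_le hn hξ'
    rwa [Real.rpow_one] at this
  rw [hrate] at hcontr
  specialize hcontr hμ'pos hxs hr (by positivity) ((by gcongr : _ ≤ _).trans h1) hν (by positivity)
    (three_fourths_mul_nu4_le ha hγ hC₁ hC₂ hG hμ'pos hμ₀ ((by gcongr : _ ≤ _).trans h2)) ?_ ?_
  · have hτs : 0 < n ^ (ξ / (2 * D)) := by positivity
    have hκ := envelopeConst_mono (a := a) (C₁ := C₁) hμ'μ
    have hκ0 := envelopeConst_pos (a := a) hC₁ hμ
    have e1 : φ / τ / 4 = φ / 4 / τ := by ring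
    rw [e1]
    refine le_trans ?_ (div_le_div_of_nonneg_right h4 hτ0.le)
    rw [div_div, mul_comm (n ^ (ξ / (2 * D))), hτR, hξR]
    have hCB : 0 ≤ C ^ 2 + 2 * B := by positivity
    have e2 : α / (R * R) * C * (μ / R') * curvBound a C₁ C₂ G
        ≤ α / (R * R) * C * (μ / R) * curvBound a C₁ C₂ G := by gcongr
    have e3 : (α / (R * R)) ^ 2 * (C ^ 2 + 2 * B) * envelopeConst a C₁ (μ / R') / (2 * (μ / R'))
        ≤ (α / (R * R)) ^ 2 * (C ^ 2 + 2 * B) * envelopeConst a C₁ μ / (2 * (μ / (R * (C ^ 2 + 1)))) := by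
      gcongr
    refine (add_le_add e2 e3).trans (le_of_eq ?_)
    field_simp
  · have e1 := mul_le_noiseLevel (a := a) (C := C) (C₂ := C₂) (G := G) (μ₀ := μ₀) hAB hμ
    have e2 := mul_le_mul_of_nonneg_right e1 hR0.le
    refine le_trans ?_ e2
    have e3 : (A + 2 * B * ‖xs‖ ^ 2) / (2 * (μ / R')) = (A + 2 * B * ‖xs‖ ^ 2) / (2 * μ) * R' := by
      field_simp
    rw [e3]
    have e4 : 0 ≤ (A + 2 * B * ‖xs‖ ^ 2) / (2 * μ) := by positivity
    have := mul_le_mul_of_nonneg_left hR'C e4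
    linarith
  specialize hchange hμ'pos hμ'le
  -- The relative change of `μ` is at most `1/n ≤ n^{-ξ'}`, and the prefactor `μ_k` is small, so the
  -- cost is a quarter of the rate.
  have hfac : 1 + curvBound a C₁ C₂ G / 2 * (μ / R) * (μ / R / (μ / R') - 1) ≤ 1 + φ / τ / 4 := by
    have e1 : μ / R / (μ / R') - 1 ≤ 1 / n := by
      have e2 : μ / R / (μ / R') = R' / R := by field_simp
      rw [e2, sub_le_iff_le_add, div_le_iff₀ hR0]
      linarith
    have e3 : 1 / n ≤ 1 / τ := by gcongr
    have e4 := mul_le_mul_of_nonneg_left (e1.trans e3)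
      (by positivity : 0 ≤ curvBound a C₁ C₂ G / 2 * (μ / R))
    have e5 := mul_le_mul_of_nonneg_right h5 (by positivity : 0 ≤ 1 / τ)
    have e6 : φ / 4 * (1 / τ) = φ / τ / 4 := by ring
    have e7 : curvBound a C₁ C₂ G / 2 * (μ / R) * (1 / τ)
        = curvBound a C₁ C₂ G / 2 * μ / R * (1 / τ) := by ring
    linarith
  have hchange' := hchange.trans (mul_le_mul_of_nonneg_right hfac hI0)
  refine hcontr.trans ?_
  set I := ∫ ω, envelope V a (μ / R) (x k ω) ∂P
  have hψ : 0 < φ / τ := by positivity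
  have e1 := mul_le_mul_of_nonneg_left hchange' (by linarith : 0 ≤ 1 - 5 / 4 * (φ / τ))
  have e2 : (1 - 5 / 4 * (φ / τ)) * ((1 + φ / τ / 4) * I) ≤ (1 - φ / τ) * I :=
    contraction_mul_growth_le _ hI0
  have e3 : D * (α / n ^ ξ) ^ 2 * (N * R)
      = omega a c C C₂ G A B ‖xs‖ α μ μ₀ / n ^ (3 * ξ / 2) := by
    rw [hR3, hξR, omega, ← hDdef, ← hNdef]
    field_simp
  linarith


end DiminishingStep

/-! ### Choice of thresholds and the convergence rates -/

theorem tendsto_const_div_rpow_atTop {b : ℝ} (X : ℝ) (hb : 0 < b) :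
    Tendsto (fun n : ℝ => X / n ^ b) atTop (𝓝 0) :=
  (tendsto_rpow_atTop hb).const_div_atTop X

theorem eventually_const_div_rpow_le {b ε : ℝ} (X : ℝ) (hb : 0 < b) (hε : 0 < ε) :
    ∀ᶠ n : ℝ in atTop, X / n ^ b ≤ ε :=
  (tendsto_const_div_rpow_atTop X hb).eventually (eventually_le_nhds hε)

theorem eventually_sq_rpow_le (S : ℝ) {D : ℝ} :
    ∀ᶠ t : ℝ in 𝓝 0, ((1 + t * S) ^ 2) ^ D ≤ 4 / 3 := by
  have hc : ContinuousAt (fun t : ℝ => ((1 + t * S) ^ 2) ^ D) 0 :=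
    ContinuousAt.rpow_const (by fun_prop) (Or.inl (by norm_num))
  have h : Tendsto (fun t : ℝ => ((1 + t * S) ^ 2) ^ D) (𝓝 0) (𝓝 1) := by
    simpa [ContinuousAt] using hc
  exact h.eventually (eventually_le_nhds (by norm_num))

/-- Convergence rates for diminishing step sizes. -/
theorem mse_le_of_diminishing_steps {m : ℕ} (xs : EuclideanSpace ℝ (Fin m))
    (a c γ C C₁ C₂ G A B r ρ : ℝ)
    (ha : 0 < a) (hc : 1 ≤ c) (hγ : 0 < γ) (hC : 0 < C) (hC₁ : 0 < C₁) (hC₂ : 0 < C₂)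
    (hG : 0 < G) (hB : 0 ≤ B) (hAB : 0 < A + 2 * B * ‖xs‖ ^ 2)
    (hr : r < ρ) (hxs : ‖xs‖ ≤ ρ) (α μ ξ : ℝ) (hα : 0 < α) (hμ : 0 < μ) (hξ : 0 < ξ)
    (hξd : ξ ≤ 2 * dExp a c / 3) :
    ∃ K₀ : ℝ, 1 ≤ K₀ ∧ ∀ K : ℝ, K₀ ≤ K →
      ∀ (V : EuclideanSpace ℝ (Fin m) → ℝ)
        (F : EuclideanSpace ℝ (Fin m) → EuclideanSpace ℝ (Fin m)),
      SystemAssumptions V F xs a c γ C C₁ C₂ G ρ →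
      ∀ (Ω : Type*) [MeasurableSpace Ω] (P : Measure Ω) [IsProbabilityMeasure P]
        (x w : ℕ → Ω → EuclideanSpace ℝ (Fin m)),
      IsTrajectory P F (fun k => α / ((k : ℝ) + K) ^ ξ) A B r x w →
      let D : ℝ := dac a c
      let d : ℝ := dExp a c
      let μ₀ : ℝ := μ / K ^ (ξ / 2)
      let φ : ℝ := phi a c γ C C₁ C₂ G A B ‖xs‖ α μ μ₀
      let ω : ℝ := omega a c C C₂ G A B ‖xs‖ α μ μ₀
      let κ : ℝ := envelopeConst a C₁ μ₀
      let E : ℕ → ℝ := mse P x xs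
      ∀ k : ℕ,
        (ξ = 2 * d / 3 →
          (φ < d - 1 →
            E k ≤ E 0 * C₂ ^ (2 / a) * κ * (K / (k + K)) ^ φ
              + κ * (1 / (k + K) ^ φ * (2 ^ d * ω / (d - 1 - φ)))) ∧
          (φ = d - 1 →
            E k ≤ E 0 * C₂ ^ (2 / a) * κ * (K / (k + K)) ^ φ
              + κ * (Real.log (k + K) / (k + K) ^ (d - 1) * (2 ^ d * ω))) ∧
          (d - 1 < φ →
            E k ≤ E 0 * C₂ ^ (2 / a) * κ * (K / (k + K)) ^ φ
              + κ * (1 / (k + K) ^ (d - 1) *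
                  (Real.exp 1 * 2 ^ d * ω / (φ - (d - 1)))))) ∧
        (ξ < 2 * d / 3 →
          E k ≤ E 0 * C₂ ^ (2 / a) * κ *
              Real.exp (-(φ * ((k + K) ^ (1 - (3 * D - 1) * ξ / (2 * D))
                  - K ^ (1 - (3 * D - 1) * ξ / (2 * D)))
                / (1 - (3 * D - 1) * ξ / (2 * D))))
            + 2 * ω * κ / (φ * (k + K) ^ (ξ / (2 * D)))) := by
  have hD := dac_pos ha hc
  have hdD : dExp a c = 3 * dac a c / (3 * dac a c - 1) := rfl
  set D := dac a c with hDdef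
  set d := dExp a c with hddef
  have h3D : 0 < 3 * D - 1 := by linarith
  have hd1 : 1 ≤ d := by
    rw [hdD, one_le_div h3D]
    linarith
  have hd32 : d ≤ 3 / 2 := by
    rw [hdD, div_le_div_iff₀ h3D (by norm_num)]
    linarith
  have hξ1 : ξ ≤ 1 := by linarith
  have hξ'eq : (3 * D - 1) * (2 * d / 3) / (2 * D) = 1 := by
    rw [hdD]
    field_simp
  set ξ' := (3 * D - 1) * ξ / (2 * D) with hξ'def
  have hξ' : ξ' ≤ 1 := by
    rw [← hξ'eq, hξ'def]
    gcongr
  have hξ'0 : 0 < ξ' := by positivity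
  -- `φ` depends on `K` through `μ₀`. As `μ₀` ranges over `[0, μ]`, monotonicity in `ν₄` and in the
  -- noise level confines `φ` to `[φlo, φhi]`, so the threshold can be fixed before `K`.
  set φlo := stepRate D α (nu4 a c γ C₁ C₂ G μ) (noiseLevel a C C₂ G A B ‖xs‖ μ 0) with hφlo
  set φhi := stepRate D α (nu4 a c γ C₁ C₂ G 0) (noiseLevel a C C₂ G A B ‖xs‖ μ μ) with hφhi
  have hlo : 0 < φlo :=
    stepRate_pos hD hα (nu4_pos ha hγ hC₁ hC₂ hG hμ.le) (noiseLevel_pos hAB hμ)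
  set S := slopeBound a C₁ C₂ G with hS
  set X := S * (√((C₂ / C₁) ^ (2 / a)) * (2 * ρ)) with hX
  set Y := α * C * μ * curvBound a C₁ C₂ G
    + α ^ 2 * (C ^ 2 + 2 * B) * envelopeConst a C₁ μ * (C ^ 2 + 1) / (2 * μ) with hY
  have hev : ∀ᶠ n : ℝ in atTop, μ * X / n ^ (ξ / 2) ≤ ρ - r
      ∧ ((1 + μ / n ^ (ξ / 2) * S) ^ 2) ^ D ≤ 4 / 3
      ∧ 1 / n ^ (1 : ℝ) ≤ C ^ 2
      ∧ Y / n ^ (ξ / (2 * D)) ≤ φlo / 4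
      ∧ curvBound a C₁ C₂ G / 2 * μ / n ^ (ξ / 2) ≤ φlo / 4
      ∧ φhi / n ^ ξ' ≤ 4 / 5
      ∧ φhi ≤ n
      ∧ (ξ' < 1 → 2 * (ξ / (2 * D)) ≤ φlo * n ^ (1 - ξ')) := by
    refine (eventually_const_div_rpow_le _ (by positivity) (by linarith)).and <|
      ((tendsto_const_div_rpow_atTop μ (by positivity)).eventually (eventually_sq_rpow_le S)).and <|
      (eventually_const_div_rpow_le _ one_pos (by positivity)).and <|
      (eventually_const_div_rpow_le _ (by positivity) (by positivity)).and <|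
      (eventually_const_div_rpow_le _ (by positivity) (by positivity)).and <|
      (eventually_const_div_rpow_le _ hξ'0 (by norm_num)).and <|
      (eventually_ge_atTop φhi).and ?_
    by_cases hlt : ξ' < 1
    · have h : Tendsto (fun n : ℝ => φlo * n ^ (1 - ξ')) atTop atTop :=
        (tendsto_rpow_atTop (by linarith)).const_mul_atTop hlo
      filter_upwards [h.eventually (eventually_ge_atTop (2 * (ξ / (2 * D))))] with n hn _ using hn
    · exact Eventually.of_forall fun n hn => absurd hn hlt
  obtain ⟨N, hN⟩ := eventually_atTop.1 hev
  refine ⟨max 1 N, le_max_left _ _, ?_⟩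
  intro K hK V F h Ω _ P _ x w hT
  intro D' d' μ₀ φ ω κ E k
  have hK1 : 1 ≤ K := (le_max_left _ _).trans hK
  have hKN : N ≤ K := (le_max_right _ _).trans hK
  have hK0 : 0 < K := by linarith
  have hn1 : ∀ k : ℕ, K ≤ (k : ℝ) + K := fun k => le_add_of_nonneg_left k.cast_nonneg
  have hn0 : ∀ k : ℕ, 0 < (k : ℝ) + K := fun k => hK0.trans_le (hn1 k)
  have hμ₀ : 0 < μ₀ := by positivity
  have hμ₀μ : μ₀ ≤ μ := div_le_self hμ.le (Real.one_le_rpow hK1 (by positivity))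
  have hφlo' : φlo ≤ φ := stepRate_mono hD hα (nu4_pos ha hγ hC₁ hC₂ hG hμ.le)
    (noiseLevel_pos hAB hμ) (nu4_anti ha hγ hC₁ hC₂ hG hμ₀.le hμ₀μ)
    (noiseLevel_mono hAB hμ le_rfl hμ₀.le)
  have hφhi' : φ ≤ φhi := stepRate_mono hD hα (nu4_pos ha hγ hC₁ hC₂ hG hμ₀.le)
    (noiseLevel_pos hAB hμ) (nu4_anti ha hγ hC₁ hC₂ hG le_rfl hμ₀.le)
    (noiseLevel_mono hAB hμ hμ₀.le hμ₀μ)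
  have hφ0 : 0 < φ := hlo.trans_le hφlo'
  have hω0 : 0 < ω := omega_pos ha hc hAB hα hμ
  have hκ0 : 0 < κ := envelopeConst_pos hC₁ hμ₀
  let u : ℕ → ℝ := fun k => ∫ ω, envelope V a (μ / ((k : ℝ) + K) ^ (ξ / 2)) (x k ω) ∂P
  have hu0 : 0 ≤ u 0 := integral_nonneg fun ω => h.envelope_nonneg hC₁ (by positivity) _
  have hφn : ∀ k : ℕ, φ / ((k : ℝ) + K) ^ ξ' ≤ 4 / 5 := by
    intro k
    have hnk := hn0 k
    obtain ⟨-, -, -, -, -, h6, -⟩ := hN _ (hKN.trans (hn1 k))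
    exact (by gcongr : _ ≤ _).trans h6
  have hrec : ∀ k : ℕ, u (k + 1) ≤ (1 - φ / ((k : ℝ) + K) ^ ξ') * u k
      + ω / ((k : ℝ) + K) ^ (3 * ξ / 2) := by
    intro k
    obtain ⟨h1, h2, h3, h4, h5, -⟩ := hN _ (hKN.trans (hn1 k))
    rw [mul_div_right_comm] at h1
    rw [Real.rpow_one] at h3
    exact hT.integral_envelope_diminishing h ha hc hγ hC hC₁ hC₂ hG hB hAB hxs hr hα hμ hμ₀.le hξ
      hξ1 hξ' k (hK1.trans (hn1 k)) rfl h1 h2 h3 (h4.trans (by linarith)) (h5.trans (by linarith))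
      (hφn k)
  have hE0 : u 0 ≤ E 0 * C₂ ^ (2 / a) :=
    hT.integral_envelope_le_mse h ha hC₁ hC₂ (by positivity) 0
  have hEk : E k ≤ κ * u k := by
    have hnk := hn0 k
    refine (hT.mse_le h ha hC₁ (μ := μ / ((k : ℝ) + K) ^ (ξ / 2)) (by positivity) k).trans ?_
    refine mul_le_mul_of_nonneg_right (envelopeConst_mono ?_)
      (integral_nonneg fun ω => h.envelope_nonneg hC₁ (by positivity) _)
    have := hn1 k
    simp only [μ₀]
    gcongr
  have hfinal : ∀ p q : ℝ, 0 ≤ p → u k ≤ u 0 * p + q →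
      E k ≤ E 0 * C₂ ^ (2 / a) * κ * p + κ * q := by
    intro p q hp hle
    have h1 := mul_le_mul_of_nonneg_left hle hκ0.le
    have h2 := mul_le_mul_of_nonneg_left hE0 (mul_nonneg hκ0.le hp)
    linarith
  have hnk := hn0 k
  refine ⟨fun heq => ?_, fun hlt => ?_⟩
  · have hξ'1 : ξ' = 1 := by
      rw [hξ'def, heq]
      exact hξ'eq
    have hd3 : 3 * ξ / 2 = d := by
      rw [heq]
      ring
    simp only [hξ'1, Real.rpow_one, hd3] at hrec
    have hφK : φ ≤ K := hφhi'.trans (hN K hKN).2.2.2.2.2.2.1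
    have hp : 0 ≤ (K / ((k : ℝ) + K)) ^ φ := by positivity
    exact ⟨fun hlt => hfinal _ _ hp
        (le_of_harmonic_recursion_of_lt hK1 hφ0 hφK hω0.le (by linarith) hu0 hrec hlt k),
      fun he => hfinal _ _ hp
        (le_of_harmonic_recursion_of_eq hK1 hφ0 hφK hω0.le (by linarith) hu0 hrec he k),
      fun hgt => hfinal _ _ hp
        (le_of_harmonic_recursion_of_gt hK1 hφ0 hφK hω0.le hd1 hu0 hrec hgt k)⟩
  · have hξ'1 : ξ' < 1 := by
      rw [← hξ'eq, hξ'def]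
      gcongr
    have hrec' : ∀ k : ℕ, u (k + 1) ≤ (1 - φ / ((k : ℝ) + K) ^ (1 - (1 - ξ'))) * u k
        + ω / ((k : ℝ) + K) ^ (1 - (1 - ξ') + ξ / (2 * D)) := by
      intro k
      have e1 : 1 - (1 - ξ') + ξ / (2 * D) = 3 * ξ / 2 := by
        rw [hξ'def]
        field_simp
        ring
      rw [e1, sub_sub_cancel]
      exact hrec k
    have := le_of_subharmonic_recursion hK0 (by linarith) (by linarith) (by positivity) hφ0 hω0.le
      hu0 (fun k => by
        rw [sub_sub_cancel]
        linarith [hφn k]) (fun k => by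
        have hnk := hn0 k
        exact ((hN _ (hKN.trans (hn1 k))).2.2.2.2.2.2.2 hξ'1).trans (by gcongr)) hrec' k
    refine (hfinal _ _ (Real.exp_pos _).le this).trans (le_of_eq ?_)
    ring

/-- Convergence up to a noise floor for constant step sizes. -/
theorem mse_le_of_constant_steps {m : ℕ} (xs : EuclideanSpace ℝ (Fin m))
    (a c γ C C₁ C₂ G A B r ρ : ℝ)
    (ha : 0 < a) (hc : 1 ≤ c) (hγ : 0 < γ) (hC : 0 < C) (hC₁ : 0 < C₁) (hC₂ : 0 < C₂)
    (hG : 0 < G) (hB : 0 ≤ B) (hAB : 0 < A + 2 * B * ‖xs‖ ^ 2)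
    (hr : r < ρ) (hxs : ‖xs‖ ≤ ρ) :
    ∃ η : ℝ, 0 < η ∧ ∀ α μ : ℝ, 0 < α → 0 < μ → μ ≤ η →
      α * μ + α ^ 2 / μ ≤ η * phi a c γ C C₁ C₂ G A B ‖xs‖ α μ μ →
        ∀ (V : EuclideanSpace ℝ (Fin m) → ℝ)
          (F : EuclideanSpace ℝ (Fin m) → EuclideanSpace ℝ (Fin m)),
        SystemAssumptions V F xs a c γ C C₁ C₂ G ρ →
        ∀ (Ω : Type*) [MeasurableSpace Ω] (P : Measure Ω) [IsProbabilityMeasure P]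
          (x w : ℕ → Ω → EuclideanSpace ℝ (Fin m)),
        IsTrajectory P F (fun _ => α) A B r x w →
        let φ : ℝ := phi a c γ C C₁ C₂ G A B ‖xs‖ α μ μ
        let ω : ℝ := omega a c C C₂ G A B ‖xs‖ α μ μ
        let κ : ℝ := envelopeConst a C₁ μ
        let E : ℕ → ℝ := mse P x xs
        ∀ k : ℕ, E k ≤ E 0 * C₂ ^ (2 / a) * κ * (1 - φ) ^ k + ω * κ / φ := by
  have hD := dac_pos ha hc
  set D := dac a c with hDdef
  have hD0 : 0 < D := by linarith
  have hρ : 0 ≤ ρ := (norm_nonneg xs).trans hxs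
  have hL := curvBound_nonneg (a := a) (C₂ := C₂) (G := G) hC₁
  have hS0 := slopeBound_pos ha hC₁ hC₂ hG
  set S := slopeBound a C₁ C₂ G with hS
  set X := S * (√((C₂ / C₁) ^ (2 / a)) * (2 * ρ)) with hX
  -- The errors linear in the envelope are at most `Q * (α μ + α²/μ)`; the smallness hypothesis and
  -- `Q * η ≤ 1/4` bring them below `φ/4`.
  set Q := C * curvBound a C₁ C₂ G + (C ^ 2 + 2 * B) * envelopeConst a C₁ 1 / 2 with hQ
  have hκ1 : 0 < envelopeConst a C₁ 1 := envelopeConst_pos hC₁ one_pos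
  have hQ0 : 0 ≤ Q := by positivity
  set b := stepRate D 1 (nu4 a c γ C₁ C₂ G 0) (noiseLevel a C C₂ G A B ‖xs‖ 1 1) with hb
  have hν0 := nu4_pos (c := c) ha hγ hC₁ hC₂ hG le_rfl
  have hN0 := noiseLevel_pos (a := a) (C := C) (C₂ := C₂) (G := G) (μ₀ := 1) hAB one_pos
  have hb0 : 0 < b := stepRate_pos hD one_pos hν0 hN0
  set θ := 1 - 1 / (3 * D) with hθ
  have h3D : 1 / (3 * D) ≤ 1 / 3 := by gcongr; linarith
  have h3D0 : 0 < 1 / (3 * D) := by positivity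
  have hθ0 : 0 < θ := by linarith
  have hev : ∀ᶠ t : ℝ in 𝓝[>] 0, t * X ≤ ρ - r ∧ ((1 + t * S) ^ 2) ^ D ≤ 4 / 3
      ∧ Q * t ≤ 1 / 4 ∧ b * t ^ θ < 1 ∧ t ≤ 1 ∧ 0 < t := by
    have hlin : ∀ y ε : ℝ, 0 < ε → ∀ᶠ t : ℝ in 𝓝[>] 0, t * y ≤ ε := by
      intro y ε hε
      have : Tendsto (fun t : ℝ => t * y) (𝓝 0) (𝓝 0) := by
        have hcont : Continuous fun t : ℝ => t * y := by fun_prop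
        simpa using hcont.tendsto 0
      exact nhdsWithin_le_nhds (this.eventually (eventually_le_nhds hε))
    have hpow : ∀ᶠ t : ℝ in 𝓝[>] 0, b * t ^ θ < 1 := by
      have hcont : ContinuousAt (fun t : ℝ => b * t ^ θ) 0 :=
        continuousAt_const.mul (Real.continuousAt_rpow_const 0 θ (Or.inr hθ0.le))
      have : Tendsto (fun t : ℝ => b * t ^ θ) (𝓝 0) (𝓝 0) := by
        simpa [ContinuousAt, Real.zero_rpow hθ0.ne'] using hcont
      exact nhdsWithin_le_nhds (this.eventually (gt_mem_nhds one_pos))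
    filter_upwards [hlin X (ρ - r) (by linarith), nhdsWithin_le_nhds (eventually_sq_rpow_le S),
      hlin Q (1 / 4) (by norm_num), hpow, hlin 1 1 one_pos, self_mem_nhdsWithin]
      with t h1 h2 h3 h4 h5 h6
    exact ⟨h1, h2, by linarith, h4, by linarith, h6⟩
  obtain ⟨η, h1, h2, h3, h4, hη1, hη0⟩ := hev.exists
  refine ⟨η, hη0, ?_⟩
  intro α μ hα hμ hμη hsmall V F h Ω _ P _ x w hT φ ω κ E k
  have hμ1 : μ ≤ 1 := hμη.trans hη1
  have hν := nu4_pos (c := c) ha hγ hC₁ hC₂ hG hμ.le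
  have hN := noiseLevel_pos (a := a) (C := C) (C₂ := C₂) (G := G) (μ₀ := μ) hAB hμ
  have hφ0 : 0 < φ := phi_pos ha hc hγ hC₁ hC₂ hG hAB hα hμ hμ.le
  have hω0 : 0 < ω := omega_pos ha hc hAB hα hμ
  have hκ0 : 0 < κ := envelopeConst_pos hC₁ hμ
  set s := α * μ + α ^ 2 / μ with hs
  have hs0 : 0 < s := by positivity
  have hX0 : 0 ≤ X := by positivity
  -- the rate is at most one
  have hφs : φ ≤ b * s ^ θ := by
    have e1 : φ ≤ stepRate D α (nu4 a c γ C₁ C₂ G 0)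
        (noiseLevel a C C₂ G A B ‖xs‖ 1 1 / μ) := by
      refine stepRate_mono hD hα hν hN (nu4_anti ha hγ hC₁ hC₂ hG le_rfl hμ.le) ?_
      refine (noiseLevel_mono hAB hμ hμ.le hμ1).trans (le_of_eq ?_)
      unfold noiseLevel
      field_simp
    refine e1.trans ?_
    have h1D : 0 ≤ 1 - 1 / D := by
      rw [sub_nonneg, div_le_one hD0]
      exact hD
    have e2 : stepRate D α (nu4 a c γ C₁ C₂ G 0) (noiseLevel a C C₂ G A B ‖xs‖ 1 1 / μ)
        = b * (α ^ (1 / D) * (α ^ 2 / μ) ^ (1 - 1 / D)) := by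
      rw [hb, stepRate, stepRate, Real.one_rpow, Real.div_rpow hN0.le hμ.le,
        Real.div_rpow (by positivity) hμ.le, ← Real.rpow_natCast α 2, ← Real.rpow_mul hα.le,
        show 2 - 1 / D = 1 / D + ((2 : ℕ) : ℝ) * (1 - 1 / D) by push_cast; ring,
        Real.rpow_add hα]
      ring
    rw [e2]
    refine mul_le_mul_of_nonneg_left ?_ hb0.le
    have e3 : α ^ 2 / μ ≤ s := le_add_of_nonneg_left (by positivity)
    have e4 : α * μ ≤ s := le_add_of_nonneg_right (by positivity)
    -- `α³` is the product of the two summands of `s`. Hence `α^{1/D} ≤ s^{2/(3D)}`, and the total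
    -- exponent is `2/(3D) + 1 - 1/D = θ`.
    have e5 : α ^ (3 : ℝ) ≤ s ^ (2 : ℝ) := by
      have e6 : α * μ * (α ^ 2 / μ) ≤ s * s := by gcongr
      have e7 : α * μ * (α ^ 2 / μ) = α ^ 3 := by field_simp
      rw [e7] at e6
      norm_cast
      linarith [sq s]
    have e8 : α ^ (1 / D) ≤ s ^ (2 / (3 * D)) := by
      have := Real.rpow_le_rpow (by positivity) e5 h3D0.le
      rw [← Real.rpow_mul hα.le, ← Real.rpow_mul hs0.le] at this
      convert this using 2 <;> field_simp
    calc α ^ (1 / D) * (α ^ 2 / μ) ^ (1 - 1 / D)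
        ≤ s ^ (2 / (3 * D)) * s ^ (1 - 1 / D) := by gcongr
      _ = s ^ θ := by
        rw [← Real.rpow_add hs0, hθ]
        congr 1
        field_simp
        ring
  -- If `φ > 1`, then `s ≤ η φ` gives `φ ≤ b (η φ)^θ ≤ b η^θ φ < φ`, since `θ ≤ 1` and `b η^θ < 1`.
  have hφ1 : φ ≤ 1 := by
    by_contra hgt
    push Not at hgt
    have e1 : s ^ θ ≤ (η * φ) ^ θ := Real.rpow_le_rpow hs0.le hsmall hθ0.le
    rw [Real.mul_rpow hη0.le hφ0.le] at e1
    have e2 : φ ^ θ ≤ φ := Real.rpow_le_self_of_one_le hgt.le (by linarith)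
    have e3 : φ ≤ b * η ^ θ * φ := by
      refine hφs.trans ((mul_le_mul_of_nonneg_left e1 hb0.le).trans ?_)
      rw [mul_assoc]
      gcongr
    nlinarith
  let u : ℕ → ℝ := fun k => ∫ ω, envelope V a μ (x k ω) ∂P
  have hu0 : ∀ k, 0 ≤ u k := fun k => integral_nonneg fun ω => h.envelope_nonneg hC₁ hμ _
  have hrec : ∀ k, u (k + 1) ≤ (1 - φ) * u k + ω := by
    intro k
    have hstep := hT.integral_envelope_contraction h ha hc hγ hC hC₁ hC₂ hG hB hμ hxs hr k hα
      ((mul_le_mul_of_nonneg_right hμη hX0).trans h1) hν hN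
      (three_fourths_mul_nu4_le ha hγ hC₁ hC₂ hG hμ hμ.le
        ((by gcongr : _ ≤ _).trans h2)) (by
        rw [← phi_eq_stepRate]
        have hκ := envelopeConst_mono (a := a) (C₁ := C₁) hμ1
        have e1 : Q * s ≤ φ / 4 := by
          have e2 := mul_le_mul_of_nonneg_left hsmall hQ0
          have e3 := mul_le_mul_of_nonneg_right h3 hφ0.le
          linarith
        refine le_trans ?_ e1
        have e4 : α ^ 2 * (C ^ 2 + 2 * B) * envelopeConst a C₁ μ / (2 * μ)
            ≤ α ^ 2 * (C ^ 2 + 2 * B) * envelopeConst a C₁ 1 / (2 * μ) := by gcongr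
        have e5 : Q * s = α * C * μ * curvBound a C₁ C₂ G
            + α ^ 2 * (C ^ 2 + 2 * B) * envelopeConst a C₁ 1 / (2 * μ)
            + (C * curvBound a C₁ C₂ G * (α ^ 2 / μ)
              + (C ^ 2 + 2 * B) * envelopeConst a C₁ 1 / 2 * (α * μ)) := by
          rw [hQ, hs]
          field_simp
          ring
        have e6 : 0 ≤ C * curvBound a C₁ C₂ G * (α ^ 2 / μ)
              + (C ^ 2 + 2 * B) * envelopeConst a C₁ 1 / 2 * (α * μ) := by positivity
        linarith) (by
        have e1 := mul_le_noiseLevel (a := a) (C := C) (C₂ := C₂) (G := G) (μ₀ := μ) hAB hμ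
        refine le_trans (le_mul_of_one_le_left (by positivity) ?_) e1
        linarith [sq_nonneg C])
    rw [← phi_eq_stepRate] at hstep
    have e : (1 - 5 / 4 * φ) * u k ≤ (1 - φ) * u k :=
      mul_le_mul_of_nonneg_right (by linarith) (hu0 k)
    exact hstep.trans (add_le_add_left e _)
  have hle := le_of_constant_recursion hφ0 hφ1 hω0.le hrec k
  have hE0 : u 0 ≤ E 0 * C₂ ^ (2 / a) := hT.integral_envelope_le_mse h ha hC₁ hC₂ hμ 0
  have hEk : E k ≤ κ * u k := hT.mse_le h ha hC₁ hμ k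
  have e1 := mul_le_mul_of_nonneg_left hle hκ0.le
  have e2 := mul_le_mul_of_nonneg_left hE0
    (mul_nonneg hκ0.le (pow_nonneg (by linarith : 0 ≤ 1 - φ) k))
  have e3 : κ * (ω / φ) = ω * κ / φ := by ring
  linarith

end NonsmoothSA

theorem mainTheorem2 {m : ℕ} (xs : EuclideanSpace ℝ (Fin m))
    (a c γ C C₁ C₂ G A B r ρ : ℝ)
    (ha : 0 < a) (hc : 1 ≤ c) (hγ : 0 < γ) (hC : 0 < C) (hC₁ : 0 < C₁) (hC₂ : 0 < C₂)
    (hG : 0 < G) (hA : 0 ≤ A) (hB : 0 ≤ B) (hAB : 0 < A + 2 * B * ‖xs‖ ^ 2)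
    (hr : r < ρ) (hxs : ‖xs‖ ≤ ρ) :
    -- diminishing steps `α / (k + K)^ξ`, with `μ_k = μ / (k + K)^(ξ/2)` and `K` large
    (∀ α μ ξ : ℝ, 0 < α → 0 < μ → 0 < ξ → ξ ≤ 2 * NonsmoothSA.dExp a c / 3 →
      ∃ K₀ : ℝ, 1 ≤ K₀ ∧ ∀ K : ℝ, K₀ ≤ K →
        ∀ (V : EuclideanSpace ℝ (Fin m) → ℝ)
          (F : EuclideanSpace ℝ (Fin m) → EuclideanSpace ℝ (Fin m)),
        NonsmoothSA.SystemAssumptions V F xs a c γ C C₁ C₂ G ρ →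
        ∀ (Ω : Type*) [MeasurableSpace Ω] (P : Measure Ω) [IsProbabilityMeasure P]
          (x w : ℕ → Ω → EuclideanSpace ℝ (Fin m)),
        NonsmoothSA.IsTrajectory P F (fun k => α / ((k : ℝ) + K) ^ ξ) A B r x w →
        let D : ℝ := NonsmoothSA.dac a c
        let d : ℝ := NonsmoothSA.dExp a c
        let μ₀ : ℝ := μ / K ^ (ξ / 2)
        let φ : ℝ := NonsmoothSA.phi a c γ C C₁ C₂ G A B ‖xs‖ α μ μ₀
        let ω : ℝ := NonsmoothSA.omega a c C C₂ G A B ‖xs‖ α μ μ₀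
        let κ : ℝ := NonsmoothSA.envelopeConst a C₁ μ₀
        let E : ℕ → ℝ := NonsmoothSA.mse P x xs
        ∀ k : ℕ,
          (ξ = 2 * d / 3 →
            (φ < d - 1 →
              E k ≤ E 0 * C₂ ^ (2 / a) * κ * (K / (k + K)) ^ φ
                + κ * (1 / (k + K) ^ φ * (2 ^ d * ω / (d - 1 - φ)))) ∧
            (φ = d - 1 →
              E k ≤ E 0 * C₂ ^ (2 / a) * κ * (K / (k + K)) ^ φ
                + κ * (Real.log (k + K) / (k + K) ^ (d - 1) * (2 ^ d * ω))) ∧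
            (d - 1 < φ →
              E k ≤ E 0 * C₂ ^ (2 / a) * κ * (K / (k + K)) ^ φ
                + κ * (1 / (k + K) ^ (d - 1) *
                    (Real.exp 1 * 2 ^ d * ω / (φ - (d - 1)))))) ∧
          (ξ < 2 * d / 3 →
            E k ≤ E 0 * C₂ ^ (2 / a) * κ *
                Real.exp (-(φ * ((k + K) ^ (1 - (3 * D - 1) * ξ / (2 * D))
                    - K ^ (1 - (3 * D - 1) * ξ / (2 * D)))
                  / (1 - (3 * D - 1) * ξ / (2 * D))))
              + 2 * ω * κ / (φ * (k + K) ^ (ξ / (2 * D))))) ∧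
    -- constant steps (`ξ = 0`), with `α` and `μ` suitably small
    (∃ η : ℝ, 0 < η ∧ ∀ α μ : ℝ, 0 < α → 0 < μ → μ ≤ η →
      α * μ + α ^ 2 / μ ≤ η * NonsmoothSA.phi a c γ C C₁ C₂ G A B ‖xs‖ α μ μ →
        ∀ (V : EuclideanSpace ℝ (Fin m) → ℝ)
          (F : EuclideanSpace ℝ (Fin m) → EuclideanSpace ℝ (Fin m)),
        NonsmoothSA.SystemAssumptions V F xs a c γ C C₁ C₂ G ρ →
        ∀ (Ω : Type*) [MeasurableSpace Ω] (P : Measure Ω) [IsProbabilityMeasure P]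
          (x w : ℕ → Ω → EuclideanSpace ℝ (Fin m)),
        NonsmoothSA.IsTrajectory P F (fun _ => α) A B r x w →
        let φ : ℝ := NonsmoothSA.phi a c γ C C₁ C₂ G A B ‖xs‖ α μ μ
        let ω : ℝ := NonsmoothSA.omega a c C C₂ G A B ‖xs‖ α μ μ
        let κ : ℝ := NonsmoothSA.envelopeConst a C₁ μ
        let E : ℕ → ℝ := NonsmoothSA.mse P x xs
        ∀ k : ℕ, E k ≤ E 0 * C₂ ^ (2 / a) * κ * (1 - φ) ^ k + ω * κ / φ) :=
  ⟨fun α μ ξ hα hμ hξ hξd => NonsmoothSA.mse_le_of_diminishing_steps xs a c γ C C₁ C₂ G A B r ρ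
      ha hc hγ hC hC₁ hC₂ hG hB hAB hr hxs α μ ξ hα hμ hξ hξd,
    NonsmoothSA.mse_le_of_constant_steps xs a c γ C C₁ C₂ G A B r ρ
      ha hc hγ hC hC₁ hC₂ hG hB hAB hr hxs⟩
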